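/- A real random variable $Z$ is called moment bounded with parameter $L>0$ if $E[|Z|^i]\le i\,L\,E[|Z|^{i-1}]$ for every integer $i\ge 1$. There is an absolute constant $R>0$ such that the following holds. Let $Y=(Y_1,\dots,Y_n)$ be independent real random variables that are all moment bounded with the same parameter $L>0$, and let $f(x)=\sum_{h} w_h\prod_{v\in V(h)}x_v^{\tau_{hv}}$ be a polynomial in $n$ variables with real coefficients $w_h$ of any sign, where $h$ ranges over finitely many distinct monomials, $V(h)\subseteq\{1,\dots,n\}$ is the set of variables occurring in $h$ and the powers $\tau_{hv}$ are positive integers. Write $q(h)=\sum_{v\in V(h)}\tau_{hv}$ for the total power of $h$, and assume that every monomial of $f$ has total power at most $q$ and that every variable occurs in it with power at most $\Gamma$. For $r\ge 0$ put $$\mu_r=\max_{h_0:\,q(h_0)=r}\ \sum_{h\succeq h_0}|w_h|\prod_{v\in V(h)\setminus V(h_0)}E\big[|Y_v^{\tau_{hv}}|\big],$$ where $h_0$ ranges over all monomials (not necessarily of $f$) of total power $r$ in the $n$ variables, the sum is over the monomials $h$ of $f$ with $h\succeq h_0$, and $h\succeq h_0$ means that $V(h)\supseteq V(h_0)$ and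 $\tau_{hv}=\tau_{h_0v}$ for all $v\in V(h_0)$. Then $f(Y)$ is integrable and, for every $\lambda>0$, $$\Pr\big[|f(Y)-E[f(Y)]|\ge\lambda\big]\le e^2\cdot\max\left\{\max_{r=1,\dots,q}e^{-\frac{\lambda^2}{\mu_0\mu_r L^r\Gamma^r R^q}},\ \max_{r=1,\dots,q}e^{-\left(\frac{\lambda}{\mu_r L^r\Gamma^r R^q}\right)^{1/r}}\right\}.$$ Here a term whose denominator is $0$ is read as $e^{-\infty}=0$, and a maximum over an empty set is $0$. -/

import Mathlib

open MeasureTheory ProbabilityTheory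

/-- A real random variable `Z` is moment bounded with parameter `L` if
`E |Z|^i ≤ i * L * E |Z|^(i-1)` for every integer `i ≥ 1`. The expectations of these nonnegative
variables are taken in `[0, ∞]`; the case `i = 1` and induction make all of them finite. -/
def MomentBounded {Ω : Type*} [MeasurableSpace Ω] (P : Measure Ω) (Z : Ω → ℝ) (L : ℝ) : Prop :=
  ∀ i : ℕ, 1 ≤ i →
    ∫⁻ ω, ENNReal.ofReal (|Z ω| ^ i) ∂P
      ≤ ENNReal.ofReal ((i : ℝ) * L) * ∫⁻ ω, ENNReal.ofReal (|Z ω| ^ (i - 1)) ∂P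

/-- `Extends h h₀`: the powered hyperedge (monomial) `h` contains all vertices of `h₀`, with the
same powers. A powered hyperedge is encoded by its exponent vector; its vertex set is the support
and its total power is the degree. (Powers on the support of `h₀` are nonzero, so the equality of
powers forces the support of `h` to contain that of `h₀`.) -/
def Extends {n : ℕ} (h h₀ : Fin n →₀ ℕ) : Prop :=
  ∀ v ∈ h₀.support, h v = h₀ v

open Classical in
/-- The sum over the monomials `h` of `f` extending `h₀` of
`|w_h| * ∏_{v ∈ V(h) \ V(h₀)} E |Y_v ^ (h v)|`, where `w_h` is the coefficient of `h` in `f`. -/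
noncomputable def muAt {n : ℕ} {Ω : Type*} [MeasurableSpace Ω] (P : Measure Ω)
    (Y : Fin n → Ω → ℝ) (f : MvPolynomial (Fin n) ℝ) (h₀ : Fin n →₀ ℕ) : ℝ :=
  ∑ h ∈ f.support with Extends h h₀,
    |f.coeff h| * ∏ v ∈ h.support \ h₀.support, ∫ ω, |Y v ω ^ h v| ∂P

/-- The smoothness parameter `μ_r`: the maximum of `muAt` over all exponent vectors `h₀` of total
power `r` (a finite set; for `n = 0 < r` it is empty and the value is `0`). -/
noncomputable def mu {n : ℕ} {Ω : Type*} [MeasurableSpace Ω] (P : Measure Ω)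
    (Y : Fin n → Ω → ℝ) (f : MvPolynomial (Fin n) ℝ) (r : ℕ) : ℝ :=
  ⨆ h₀ : {h₀ : Fin n →₀ ℕ // h₀.degree = r}, muAt P Y f h₀.1

/-- `exp (-(a / b))` for `a > 0` and `b ≥ 0`, where `exp (-(a / 0)) = exp (-∞) = 0`. -/
noncomputable def expNegDiv (a b : ℝ) : ℝ :=
  if b = 0 then 0 else Real.exp (-(a / b))

/-- `exp (-(a / b) ^ (1 / r))` for `a > 0`, `b ≥ 0` and `r ≥ 1`, where the value for `b = 0` is
`exp (-∞) = 0`. -/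
noncomputable def expNegDivRoot (a b : ℝ) (r : ℕ) : ℝ :=
  if b = 0 then 0 else Real.exp (-((a / b) ^ (1 / (r : ℝ))))

/-! The tail follows from a bound `Λ ^ k` on the central moments of even order `k`. If the maximum
on the right is `exp (-κ)`, Markov's inequality with `Λ = t / e` and `k` the largest even integer up
to `κ` gives `exp (-k) ≤ exp (2 - κ)`; this is where `e ^ 2` comes from.

For the moments, write `G = f(Y) - E f(Y)` as a sum of martingale differences `A_v`
(`eval_sub_integral_eq_sum`), so that `E G ^ k = ∑ E [A_v G ^ (k - 1)]`. In the summand `v` split `G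
= D_v + E_v`, where `E_v` is the mean of `G` over the coordinate `v`. The binomial term without
`D_v` vanishes because `A_v` is centred in `Y_v`; in the other terms Jensen's inequality puts `|G|`
back for `|E_v|` (`integral_mul_pow_le`). What remains is `E [Q_j |G| ^ (k - j - 2)]`, where `Q_j`
is dominated by `clusterPoly`: products of `j + 2` monomials through a common vertex `v`, with `Y_v`
integrated out, summed over `v`. A Young-type inequality (`mul_pow_le_one_add`) then gives `x ≤ (2 +
x) / 12` for `x = E (|G| / Λ) ^ k`, once the moments of `Q_j` are controlled.

Those moments are expanded one monomial at a time. Having chosen monomials with product `|Y| ^ a`,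
one sums the next monomial under the law tilted by `|Y| ^ a`. Moment boundedness limits how much the
tilt raises moments, and the smoothness parameters limit how many monomials meet `a`
(`sum_meeting_le`). Only `O(k)` monomials are ever multiplied, so scale `K = 2 * k` in `IsSmooth`
suffices: it yields `T`, which contains `k ^ s * μ_s` and is responsible for the root terms. A pair
of monomials that meet each other but not `a` is independent of the tilt and is estimated at scale
`1`, yielding `k * T' * μ_0`, linear in `k`; this is responsible for the Gaussian terms
(`IsSmooth.sum_pairs_le`). -/

/-- Abstract absolute moment sequences `m u i = E |Y_u| ^ i` of moment bounded variables. -/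
structure IsMomentSeq {ι : Type*} (m : ι → ℕ → ℝ) (L : ℝ) : Prop where
  zero : ∀ u, m u 0 = 1
  nonneg : ∀ u i, 0 ≤ m u i
  step : ∀ u i, m u (i + 1) ≤ ((i : ℝ) + 1) * L * m u i
  mul_le : ∀ u i j, m u i * m u j ≤ m u (i + j)

/-- The moment of the monomial with exponent vector `a`. -/
noncomputable def momentProd {ι : Type*} [Fintype ι] (m : ι → ℕ → ℝ) (a : ι →₀ ℕ) : ℝ :=
  ∏ u, m u (a u)

/-- The growth factor of the moments of order `a` when the order is raised by `τ`. -/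
noncomputable def growthRate (L : ℝ) (a τ : ℕ) : ℝ :=
  L ^ τ * ((a + 1).ascFactorial τ : ℝ)

/-- Exponent vectors whose size is that of a product of `N` monomials. -/
def IsSmall {ι : Type*} (q Γ N : ℕ) (a : ι →₀ ℕ) : Prop :=
  a.degree ≤ q * N ∧ ∀ u, a u ≤ Γ * N

/-- The weighted mass of the monomials in `S` that extend `h₀`. -/
noncomputable def extMass {ι : Type*} [Fintype ι] [DecidableEq ι] (m : ι → ℕ → ℝ)
    (S : Finset (ι →₀ ℕ)) (w : (ι →₀ ℕ) → ℝ) (h₀ : ι →₀ ℕ) : ℝ :=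
  ∑ h ∈ S with (∀ v ∈ h₀.support, h v = h₀ v), w h * ∏ u ∈ h₀.supportᶜ, m u (h u)

/-! ### Moment sequences and their growth -/

section Moments

variable {ι : Type*} {m : ι → ℕ → ℝ} {L : ℝ}

lemma growthRate_nonneg (hL : 0 ≤ L) (a τ : ℕ) : 0 ≤ growthRate L a τ := by
  unfold growthRate; positivity

lemma IsMomentSeq.le_growthRate (hm : IsMomentSeq m L) (hL : 0 ≤ L) (u : ι) (a τ : ℕ) :
    m u (a + τ) ≤ m u a * growthRate L a τ := by
  induction τ with
  | zero => simp [growthRate]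
  | succ τ ih =>
    have h1 := hm.step u (a + τ)
    have h2 : ((a + τ : ℕ) + 1 : ℝ) * L * m u (a + τ)
        ≤ ((a + τ : ℕ) + 1 : ℝ) * L * (m u a * growthRate L a τ) := by gcongr
    refine (h1.trans h2).trans (le_of_eq ?_)
    simp only [growthRate, Nat.ascFactorial_succ, pow_succ]
    push_cast
    ring

variable [Fintype ι]

lemma IsMomentSeq.momentProd_nonneg (hm : IsMomentSeq m L) (a : ι →₀ ℕ) : 0 ≤ momentProd m a :=
  Finset.prod_nonneg fun u _ => hm.nonneg u _

lemma IsMomentSeq.momentProd_zero (hm : IsMomentSeq m L) : momentProd m (0 : ι →₀ ℕ) = 1 := by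
  simp [momentProd, hm.zero]

lemma IsMomentSeq.momentProd_mul_le (hm : IsMomentSeq m L) (a b : ι →₀ ℕ) :
    momentProd m a * momentProd m b ≤ momentProd m (a + b) := by
  unfold momentProd
  rw [← Finset.prod_mul_distrib]
  exact Finset.prod_le_prod (fun u _ => mul_nonneg (hm.nonneg u _) (hm.nonneg u _))
    fun u _ => hm.mul_le u _ _

/-- Multiplying by a monomial `h` under the tilt by `a` costs the growth factor at vertices already
in `a` and the plain moment elsewhere. This reduces tilted sums to sums over the untilted law. -/
lemma IsMomentSeq.momentProd_add_le [DecidableEq ι] (hm : IsMomentSeq m L) (hL : 0 ≤ L)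
    (a h : ι →₀ ℕ) :
    momentProd m (a + h) ≤ momentProd m a *
      ∏ u, (if u ∈ a.support then growthRate L (a u) (h u) else m u (h u)) := by
  unfold momentProd
  rw [← Finset.prod_mul_distrib]
  refine Finset.prod_le_prod (fun u _ => hm.nonneg u _) fun u _ => ?_
  split_ifs with hu
  · exact hm.le_growthRate hL u _ _
  · have : a u = 0 := by simpa using hu
    simp [this, hm.zero]

end Moments

/-! ### Mass of the next monomial under a tilted law -/

section Steps

variable {ι : Type*} [Fintype ι] [DecidableEq ι] {m : ι → ℕ → ℝ} {L : ℝ}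
  {S : Finset (ι →₀ ℕ)} {w : (ι →₀ ℕ) → ℝ}

/-- Group the monomials by their restriction `g` to `A`. The factors on `A` depend only on `g`, and
the rest of a group sums to at most `extMass` at `g`, which is nonzero since `A` is met. Summing the
resulting products over all powers up to `Γ` on `A` factorizes over the vertices. The factors `b`
are left free so that the power `0` can be excluded at one vertex. -/
lemma sum_meeting_le (hm : ∀ u i, 0 ≤ m u i) (hm0 : ∀ u, m u 0 = 1) (hw : ∀ h, 0 ≤ w h) {Γ : ℕ}
    (hΓ : ∀ h ∈ S, ∀ u, h u ≤ Γ) (A : Finset ι) (b : ι → ℕ → ℝ) (hb : ∀ u i, 0 ≤ b u i)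
    {T θ : ℝ} (hT0 : 0 ≤ T) (hθ : 0 ≤ θ)
    (hT : ∀ h₀ : ι →₀ ℕ, h₀ ≠ 0 → extMass m S w h₀ ≤ T * θ ^ h₀.degree) :
    ∑ h ∈ S with (∃ u ∈ A, h u ≠ 0), w h * ∏ u, (if u ∈ A then b u (h u) else m u (h u))
      ≤ T * ∏ u ∈ A, ∑ τ ∈ Finset.range (Γ + 1), b u τ * θ ^ τ := by
  set S' := S.filter (fun h => ∃ u ∈ A, h u ≠ 0) with hS'
  let res : (ι →₀ ℕ) → (ι →₀ ℕ) := fun h => h.filter (· ∈ A)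
  rw [← Finset.sum_fiberwise_of_maps_to (t := S'.image res) (g := res)
    (fun i hi => Finset.mem_image_of_mem _ hi)]
  have resA : ∀ h u, u ∈ A → res h u = h u := fun h u hu => by simp [res, hu]
  have resnA : ∀ h u, u ∉ A → res h u = 0 := fun h u hu => by simp [res, hu]
  have key : ∀ g ∈ S'.image res,
      ∑ h ∈ S' with res h = g, w h * ∏ u, (if u ∈ A then b u (h u) else m u (h u))
        ≤ T * ∏ u ∈ A, (b u (g u) * θ ^ (g u)) := by
    intro g hg
    have hgA : ∀ u, u ∉ A → g u = 0 := by
      obtain ⟨h, -, rfl⟩ := Finset.mem_image.1 hg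
      exact resnA h
    have hg0 : g ≠ 0 := by
      obtain ⟨h, hh, rfl⟩ := Finset.mem_image.1 hg
      obtain ⟨u, hu, hu0⟩ := (Finset.mem_filter.1 hh).2
      intro h0
      apply hu0
      rw [← resA h u hu, h0]; rfl
    have hdeg : θ ^ g.degree = ∏ u ∈ A, θ ^ (g u) := by
      rw [Finset.prod_pow_eq_pow_sum, Finsupp.degree_eq_sum]
      congr 1
      exact (Finset.sum_subset (Finset.subset_univ A) fun u _ hu => hgA u hu).symm
    have hterm : ∀ h ∈ S'.filter (fun h => res h = g),
        w h * ∏ u, (if u ∈ A then b u (h u) else m u (h u))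
          = (∏ u ∈ A, b u (g u)) * (w h * ∏ u ∈ g.supportᶜ, m u (h u)) := by
      intro h hh
      have hres : res h = g := (Finset.mem_filter.1 hh).2
      have e1 : ∏ u, (if u ∈ A then b u (h u) else m u (h u))
          = (∏ u ∈ A, b u (g u)) * ∏ u ∈ Aᶜ, m u (h u) := by
        rw [← Finset.prod_mul_prod_compl A]
        congr 1
        · refine Finset.prod_congr rfl fun u hu => ?_
          rw [if_pos hu, ← hres, resA h u hu]
        · refine Finset.prod_congr rfl fun u hu => ?_
          rw [if_neg (Finset.mem_compl.1 hu)]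
      -- Vertices of `A` outside the support of `g` have power `0` in `h`, hence contribute `m u 0 =
      -- 1`.
      have e2 : ∏ u ∈ Aᶜ, m u (h u) = ∏ u ∈ g.supportᶜ, m u (h u) := by
        refine Finset.prod_subset ?_ ?_
        · intro u hu
          simp only [Finset.mem_compl, Finsupp.mem_support_iff, not_not] at hu ⊢
          exact hgA u hu
        · intro u hu hu'
          simp only [Finset.mem_compl, Finsupp.mem_support_iff, not_not] at hu hu'
          rw [← resA h u hu', hres, hu, hm0]
      rw [e1, e2]; ring
    rw [Finset.sum_congr rfl hterm, ← Finset.mul_sum, Finset.prod_mul_distrib, ← hdeg]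
    have hle : ∑ h ∈ S' with res h = g, w h * ∏ u ∈ g.supportᶜ, m u (h u) ≤ extMass m S w g := by
      unfold extMass
      refine Finset.sum_le_sum_of_subset_of_nonneg ?_
        (fun h _ _ => mul_nonneg (hw h) (Finset.prod_nonneg fun u _ => hm u _))
      intro h hh
      obtain ⟨h1, h2⟩ := Finset.mem_filter.1 hh
      refine Finset.mem_filter.2 ⟨(Finset.mem_filter.1 h1).1, fun v hv => ?_⟩
      have hvA : v ∈ A := by
        by_contra hvA
        exact (Finsupp.mem_support_iff.1 hv) (hgA v hvA)
      rw [← h2, resA h v hvA]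
    have hB : 0 ≤ ∏ u ∈ A, b u (g u) := Finset.prod_nonneg fun u _ => hb u _
    calc _ ≤ (∏ u ∈ A, b u (g u)) * (T * θ ^ g.degree) :=
          mul_le_mul_of_nonneg_left (hle.trans (hT g hg0)) hB
      _ = _ := by ring
  refine (Finset.sum_le_sum key).trans ?_
  rw [← Finset.mul_sum, Finset.prod_sum]
  refine mul_le_mul_of_nonneg_left ?_ hT0
  let φ : (ι →₀ ℕ) → (∀ u ∈ A, ℕ) := fun g u _ => g u
  have hinj : Set.InjOn φ (S'.image res : Finset (ι →₀ ℕ)) := by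
    intro g hg g' hg' hgg
    obtain ⟨h, -, rfl⟩ := Finset.mem_image.1 (Finset.mem_coe.1 hg)
    obtain ⟨h', -, rfl⟩ := Finset.mem_image.1 (Finset.mem_coe.1 hg')
    ext u
    by_cases hu : u ∈ A
    · exact congrFun (congrFun hgg u) hu
    · rw [resnA h u hu, resnA h' u hu]
  have himg : ∑ g ∈ S'.image res, ∏ u ∈ A, (b u (g u) * θ ^ (g u))
      = ∑ p ∈ (S'.image res).image φ, ∏ x ∈ A.attach, (b x.1 (p x.1 x.2) * θ ^ (p x.1 x.2)) := by
    rw [Finset.sum_image hinj]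
    refine Finset.sum_congr rfl fun g _ => ?_
    exact (Finset.prod_attach A fun u => b u (g u) * θ ^ (g u)).symm
  rw [himg]
  refine Finset.sum_le_sum_of_subset_of_nonneg ?_ fun p _ _ =>
    Finset.prod_nonneg fun x _ => mul_nonneg (hb _ _) (pow_nonneg hθ _)
  intro p hp
  obtain ⟨g, hg, rfl⟩ := Finset.mem_image.1 hp
  obtain ⟨h, hh, rfl⟩ := Finset.mem_image.1 hg
  refine Finset.mem_pi.2 fun u hu => ?_
  have := hΓ h (Finset.mem_filter.1 hh).1 u
  simp only [φ, resA h u hu, Finset.mem_range]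
  omega

/-- Since `a + τ ≤ 2 * K * Γ` for `2 ≤ τ ≤ Γ`, each factor of the rising factorial after the first
is halved by the weight `1 / (4 * K * L * Γ)`. The sum is thus at most twice its leading part `(a +
1) / (4 * K * Γ)`, and `a + 1 ≤ 2 * a`. -/
lemma sum_growthRate_le (hL : 0 < L) {K Γ a : ℕ} (hK : 1 ≤ K) (hΓ : 1 ≤ Γ) (ha : 1 ≤ a)
    (haK : a ≤ Γ * K) :
    ∑ s ∈ Finset.range Γ, growthRate L a (s + 1) * (1 / (4 * K * L * Γ)) ^ (s + 1)
      ≤ a / (Γ * K) := by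
  have hK' : (1 : ℝ) ≤ K := by exact_mod_cast hK
  have hΓ' : (1 : ℝ) ≤ Γ := by exact_mod_cast hΓ
  have ha' : (1 : ℝ) ≤ a := by exact_mod_cast ha
  have haK' : (a : ℝ) ≤ Γ * K := by exact_mod_cast haK
  have hasc : ∀ s, s < Γ → ((a + 1).ascFactorial (s + 1) : ℝ) ≤ (a + 1) * (2 * K * Γ) ^ s := by
    intro s
    induction s with
    | zero => intro _; simp [Nat.ascFactorial_succ]
    | succ s ih =>
      intro hs
      rw [Nat.ascFactorial_succ]
      push_cast
      have h1 := ih (by omega)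
      have hs' : (s : ℝ) + 1 + 1 ≤ Γ := by exact_mod_cast hs
      have h2 : (a : ℝ) + 1 + (s + 1) ≤ 2 * K * Γ := by nlinarith
      calc ((a : ℝ) + 1 + (s + 1)) * ((a + 1).ascFactorial (s + 1) : ℝ)
          ≤ (2 * K * Γ) * ((a + 1) * (2 * K * Γ) ^ s) := by gcongr
        _ = _ := by ring
  have hterm : ∀ s ∈ Finset.range Γ,
      growthRate L a (s + 1) * (1 / (4 * K * L * Γ)) ^ (s + 1)
        ≤ (a + 1) / (4 * K * Γ) * (1 / 2 : ℝ) ^ s := by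
    intro s hs
    have h1 := hasc s (Finset.mem_range.1 hs)
    unfold growthRate
    calc L ^ (s + 1) * ((a + 1).ascFactorial (s + 1) : ℝ) * (1 / (4 * K * L * Γ)) ^ (s + 1)
        ≤ L ^ (s + 1) * ((a + 1) * (2 * K * Γ) ^ s) * (1 / (4 * K * L * Γ)) ^ (s + 1) := by
          gcongr
      _ = (a + 1) * (L * (1 / (4 * K * L * Γ))) *
            (2 * K * Γ * (L * (1 / (4 * K * L * Γ)))) ^ s := by
          rw [mul_pow (2 * (K : ℝ) * Γ), mul_pow L, pow_succ, pow_succ]; ring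
      _ = _ := by
          have e1 : L * (1 / (4 * K * L * Γ)) = 1 / (4 * (K : ℝ) * Γ) := by
            field_simp
          have e2 : 2 * K * Γ * (1 / (4 * (K : ℝ) * Γ)) = 1 / 2 := by
            field_simp; norm_num
          rw [e1, e2]; ring
  refine (Finset.sum_le_sum hterm).trans ?_
  rw [← Finset.mul_sum]
  have hgeo : ∑ s ∈ Finset.range Γ, (1 / 2 : ℝ) ^ s ≤ 2 := by
    have := geom_sum_eq (x := (1 / 2 : ℝ)) (by norm_num) Γ
    rw [this]
    have : (0 : ℝ) ≤ (1 / 2) ^ Γ := by positivity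
    rw [div_le_iff_of_neg (by norm_num)]; linarith
  calc (a + 1) / (4 * K * Γ) * ∑ s ∈ Finset.range Γ, (1 / 2 : ℝ) ^ s
      ≤ (a + 1) / (4 * K * Γ) * 2 := by gcongr
    _ ≤ (2 * a) / (4 * K * Γ) * 2 := by gcongr; linarith
    _ = a / (Γ * K) := by field_simp; norm_num

/-- Smoothness at scale `K`: raising the total power by one costs `4 * K * L * Γ`. -/
structure IsSmooth (m : ι → ℕ → ℝ) (L : ℝ) (S : Finset (ι →₀ ℕ)) (w : (ι →₀ ℕ) → ℝ)
    (q Γ K : ℕ) (T : ℝ) : Prop where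
  momentSeq : IsMomentSeq m L
  L_pos : 0 < L
  one_le_scale : 1 ≤ K
  one_le_power : 1 ≤ Γ
  weight_nonneg : ∀ h, 0 ≤ w h
  power_le : ∀ h ∈ S, ∀ u, h u ≤ Γ
  degree_le : ∀ h ∈ S, h.degree ≤ q
  T_nonneg : 0 ≤ T
  extMass_le : ∀ h₀ : ι →₀ ℕ, h₀ ≠ 0 → extMass m S w h₀ ≤ T * (1 / (4 * K * L * Γ)) ^ h₀.degree

variable {q Γ K : ℕ} {T : ℝ}

/-- Each factor is at most `1 + a u / K ≤ exp (a u / K)`, and the degree of `a` is at most `q * K`.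
-/
lemma IsSmooth.prod_le (hs : IsSmooth m L S w q Γ K T) {a : ι →₀ ℕ} (ha : IsSmall q Γ K a)
    (A : Finset ι) (hA : A ⊆ a.support) :
    ∏ u ∈ A, ∑ τ ∈ Finset.range (Γ + 1), growthRate L (a u) τ * (1 / (4 * K * L * Γ)) ^ τ
      ≤ Real.exp q := by
  have hK : (1 : ℝ) ≤ K := by exact_mod_cast hs.one_le_scale
  have hΓ : (1 : ℝ) ≤ Γ := by exact_mod_cast hs.one_le_power
  have hL := hs.L_pos
  have h1 : ∀ u ∈ A,
      ∑ τ ∈ Finset.range (Γ + 1), growthRate L (a u) τ * (1 / (4 * K * L * Γ)) ^ τ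
        ≤ Real.exp (a u / K) := by
    intro u hu
    rw [Finset.sum_range_succ']
    have hau : 1 ≤ a u := Nat.one_le_iff_ne_zero.2 (Finsupp.mem_support_iff.1 (hA hu))
    have h2 := sum_growthRate_le hs.L_pos hs.one_le_scale hs.one_le_power hau (ha.2 u)
    have h3 : (a u : ℝ) / (Γ * K) ≤ a u / K := by
      gcongr; nlinarith
    have h4 : growthRate L (a u) 0 * (1 / (4 * K * L * Γ)) ^ 0 = 1 := by simp [growthRate]
    rw [h4]
    exact (add_le_add_left (h2.trans h3) 1).trans (Real.add_one_le_exp _)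
  refine (Finset.prod_le_prod (fun u _ => Finset.sum_nonneg fun τ _ =>
    mul_nonneg (growthRate_nonneg hL.le _ _) (by positivity)) h1).trans ?_
  rw [← Real.exp_sum]
  refine Real.exp_le_exp.2 ?_
  rw [← Finset.sum_div, div_le_iff₀ (by linarith)]
  have h5 : ∑ u ∈ A, a u ≤ q * K := by
    refine le_trans ?_ ha.1
    rw [Finsupp.degree_eq_sum]
    exact Finset.sum_le_sum_of_subset (Finset.subset_univ A)
  exact_mod_cast h5

/-- The total mass, under the measure tilted by `a`, of the monomials meeting `a`. -/
lemma IsSmooth.sum_meeting_le (hs : IsSmooth m L S w q Γ K T) {a : ι →₀ ℕ}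
    (ha : IsSmall q Γ K a) :
    ∑ h ∈ S with (∃ u ∈ a.support, h u ≠ 0), w h * momentProd m (a + h)
      ≤ T * Real.exp q * momentProd m a := by
  have hL := hs.L_pos
  have h0 := hs.momentSeq.momentProd_nonneg a
  have h1 := _root_.sum_meeting_le hs.momentSeq.nonneg hs.momentSeq.zero hs.weight_nonneg
    hs.power_le a.support (fun u => growthRate L (a u))
    (fun u i => growthRate_nonneg hL.le _ _) hs.T_nonneg (by positivity) hs.extMass_le
  calc ∑ h ∈ S with (∃ u ∈ a.support, h u ≠ 0), w h * momentProd m (a + h)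
      ≤ ∑ h ∈ S with (∃ u ∈ a.support, h u ≠ 0), momentProd m a * (w h *
          ∏ u, (if u ∈ a.support then growthRate L (a u) (h u) else m u (h u))) := by
        refine Finset.sum_le_sum fun h _ => ?_
        have := mul_le_mul_of_nonneg_left (hs.momentSeq.momentProd_add_le hL.le a h)
          (hs.weight_nonneg h)
        linarith
    _ = momentProd m a * _ := (Finset.mul_sum _ _ _).symm
    _ ≤ momentProd m a * (T * Real.exp q) := by
        refine mul_le_mul_of_nonneg_left (h1.trans ?_) h0
        exact mul_le_mul_of_nonneg_left (hs.prod_le ha _ subset_rfl) hs.T_nonneg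
    _ = _ := by ring

/-- The total mass, under the measure tilted by `a`, of the monomials containing a vertex `v`
at which `a` is positive but small. -/
lemma IsSmooth.sum_containing_le (hs : IsSmooth m L S w q Γ K T) {a : ι →₀ ℕ}
    (ha : IsSmall q Γ K a) {v : ι} (hv : a v ≠ 0) {i : ℕ} (hi : a v ≤ Γ * i) :
    ∑ h ∈ S with h v ≠ 0, w h * momentProd m (a + h)
      ≤ T * Real.exp q * (i / K) * momentProd m a := by
  have hL := hs.L_pos
  have hK : (1 : ℝ) ≤ K := by exact_mod_cast hs.one_le_scale
  have hΓ : (1 : ℝ) ≤ Γ := by exact_mod_cast hs.one_le_power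
  have h0 := hs.momentSeq.momentProd_nonneg a
  have hvA : v ∈ a.support := Finsupp.mem_support_iff.2 hv
  -- Dropping the power `0` at `v` removes the leading `1` of that factor, so it is at most `a v /
  -- (Γ * K) ≤ i / K`: the gain over `IsSmooth.sum_meeting_le`.
  let b : ι → ℕ → ℝ := fun u τ => if u = v ∧ τ = 0 then 0 else growthRate L (a u) τ
  have hb : ∀ u i, 0 ≤ b u i := fun u i => by
    simp only [b]; split_ifs
    · exact le_rfl
    · exact growthRate_nonneg hL.le _ _
  have h1 := _root_.sum_meeting_le hs.momentSeq.nonneg hs.momentSeq.zero hs.weight_nonneg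
    hs.power_le a.support b hb hs.T_nonneg (θ := 1 / (4 * K * L * Γ)) (by positivity)
    hs.extMass_le
  have hprod : ∏ u ∈ a.support,
      ∑ τ ∈ Finset.range (Γ + 1), b u τ * (1 / (4 * K * L * Γ)) ^ τ ≤ (i / K) * Real.exp q := by
    rw [← Finset.mul_prod_erase _ _ hvA]
    have hb1 : ∏ u ∈ a.support.erase v,
        ∑ τ ∈ Finset.range (Γ + 1), b u τ * (1 / (4 * K * L * Γ)) ^ τ ≤ Real.exp q := by
      refine le_trans (le_of_eq ?_) (hs.prod_le ha (a.support.erase v) (Finset.erase_subset _ _))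
      refine Finset.prod_congr rfl fun u hu => Finset.sum_congr rfl fun τ _ => ?_
      simp [b, Finset.ne_of_mem_erase hu]
    have hb2 : ∑ τ ∈ Finset.range (Γ + 1), b v τ * (1 / (4 * K * L * Γ)) ^ τ ≤ i / K := by
      rw [Finset.sum_range_succ']
      have h2 := sum_growthRate_le hs.L_pos hs.one_le_scale hs.one_le_power
        (Nat.one_le_iff_ne_zero.2 hv) (ha.2 v)
      have h3 : (a v : ℝ) / (Γ * K) ≤ i / K := by
        have : (a v : ℝ) ≤ Γ * i := by exact_mod_cast hi
        rw [div_le_div_iff₀ (by positivity) (by positivity)]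
        nlinarith
      simpa [b] using h2.trans h3
    refine mul_le_mul hb2 hb1 (Finset.prod_nonneg fun u _ => Finset.sum_nonneg fun τ _ =>
      mul_nonneg (hb _ _) (by positivity)) (by positivity)
  calc ∑ h ∈ S with h v ≠ 0, w h * momentProd m (a + h)
      ≤ ∑ h ∈ S with h v ≠ 0, momentProd m a * (w h *
          ∏ u, (if u ∈ a.support then b u (h u) else m u (h u))) := by
        refine Finset.sum_le_sum fun h hh => ?_
        have hhv : h v ≠ 0 := (Finset.mem_filter.1 hh).2
        have := mul_le_mul_of_nonneg_left (hs.momentSeq.momentProd_add_le hL.le a h)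
          (hs.weight_nonneg h)
        have e : ∏ u, (if u ∈ a.support then b u (h u) else m u (h u))
            = ∏ u, (if u ∈ a.support then growthRate L (a u) (h u) else m u (h u)) := by
          refine Finset.prod_congr rfl fun u _ => ?_
          by_cases huv : u = v
          · subst huv; simp [b, hhv]
          · simp [b, huv]
        rw [e]; linarith
    _ ≤ ∑ h ∈ S with (∃ u ∈ a.support, h u ≠ 0), momentProd m a * (w h *
          ∏ u, (if u ∈ a.support then b u (h u) else m u (h u))) := by
        refine Finset.sum_le_sum_of_subset_of_nonneg ?_ fun h _ _ => ?_
        · intro h hh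
          rw [Finset.mem_filter] at hh ⊢
          exact ⟨hh.1, v, hvA, hh.2⟩
        · refine mul_nonneg h0 (mul_nonneg (hs.weight_nonneg h) (Finset.prod_nonneg fun u _ => ?_))
          split_ifs
          · exact hb _ _
          · exact hs.momentSeq.nonneg _ _
    _ = momentProd m a * _ := (Finset.mul_sum _ _ _).symm
    _ ≤ momentProd m a * (T * ((i / K) * Real.exp q)) := by
        refine mul_le_mul_of_nonneg_left (h1.trans ?_) h0
        exact mul_le_mul_of_nonneg_left hprod hs.T_nonneg
    _ = _ := by ring

end Steps

/-! ### Expectation as a linear functional, domination, and integrating out a variable -/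

section Functional

open MvPolynomial

variable {ι : Type*} {m : ι → ℕ → ℝ} {L : ℝ}

/-- Polynomials with nonnegative coefficients. -/
def NonnegCoeff (P : MvPolynomial ι ℝ) : Prop := ∀ e, 0 ≤ P.coeff e

namespace NonnegCoeff

variable {P Q : MvPolynomial ι ℝ}

lemma monomial (e : ι →₀ ℕ) {c : ℝ} (hc : 0 ≤ c) : NonnegCoeff (MvPolynomial.monomial e c) := by
  classical
  intro e'
  rw [coeff_monomial]
  split_ifs <;> simp [hc]

lemma C {c : ℝ} (hc : 0 ≤ c) : NonnegCoeff (MvPolynomial.C c : MvPolynomial ι ℝ) :=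
  monomial 0 hc

lemma X (u : ι) : NonnegCoeff (MvPolynomial.X u : MvPolynomial ι ℝ) :=
  monomial _ zero_le_one

lemma add (hP : NonnegCoeff P) (hQ : NonnegCoeff Q) : NonnegCoeff (P + Q) := fun e => by
  rw [coeff_add]; exact add_nonneg (hP e) (hQ e)

lemma mul (hP : NonnegCoeff P) (hQ : NonnegCoeff Q) : NonnegCoeff (P * Q) := fun e => by
  classical
  rw [coeff_mul]; exact Finset.sum_nonneg fun x _ => mul_nonneg (hP _) (hQ _)

lemma pow (hP : NonnegCoeff P) (k : ℕ) : NonnegCoeff (P ^ k) := by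
  induction k with
  | zero => simpa using C (ι := ι) zero_le_one
  | succ k ih => rw [pow_succ]; exact ih.mul hP

lemma sum {κ : Type*} {s : Finset κ} {P : κ → MvPolynomial ι ℝ}
    (hP : ∀ i ∈ s, NonnegCoeff (P i)) : NonnegCoeff (∑ i ∈ s, P i) := fun e => by
  rw [coeff_sum]; exact Finset.sum_nonneg fun i hi => hP i hi e

end NonnegCoeff

variable [Fintype ι]

/-- The expectation of a polynomial in variables with moments `m`. -/
noncomputable def momentEval (m : ι → ℕ → ℝ) : MvPolynomial ι ℝ →ₗ[ℝ] ℝ :=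
  (basisMonomials ι ℝ).constr ℝ (momentProd m)

lemma momentEval_monomial (e : ι →₀ ℕ) (c : ℝ) :
    momentEval m (monomial e c) = c * momentProd m e := by
  have h1 : monomial e c = c • monomial e (1 : ℝ) := by rw [smul_monomial]; simp
  have h2 : momentEval m (monomial e (1 : ℝ)) = momentProd m e := by
    have := (basisMonomials ι ℝ).constr_basis ℝ (momentProd m) e
    rwa [coe_basisMonomials] at this
  rw [h1, map_smul, h2, smul_eq_mul]

lemma momentEval_C_mul (c : ℝ) (P : MvPolynomial ι ℝ) :
    momentEval m (C c * P) = c * momentEval m P := by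
  rw [C_mul', map_smul, smul_eq_mul]

lemma momentEval_mul_eq_sum (P R : MvPolynomial ι ℝ) :
    momentEval m (P * R) = ∑ e ∈ P.support, P.coeff e * momentEval m (monomial e 1 * R) := by
  conv_lhs => rw [P.as_sum, Finset.sum_mul, map_sum]
  refine Finset.sum_congr rfl fun e _ => ?_
  rw [← momentEval_C_mul, ← mul_assoc, C_mul_monomial, mul_one]

lemma momentEval_eq_sum (P : MvPolynomial ι ℝ) :
    momentEval m P = ∑ e ∈ P.support, P.coeff e * momentProd m e := by
  have := momentEval_mul_eq_sum (m := m) P 1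
  simpa [momentEval_monomial] using this

/-- `P` has a smaller expectation than `Q` against every polynomial with nonnegative
coefficients. -/
structure Dominated (m : ι → ℕ → ℝ) (P Q : MvPolynomial ι ℝ) : Prop where
  left : NonnegCoeff P
  right : NonnegCoeff Q
  le : ∀ R, NonnegCoeff R → momentEval m (P * R) ≤ momentEval m (Q * R)

namespace Dominated

variable {P Q P' Q' : MvPolynomial ι ℝ}

lemma refl (hP : NonnegCoeff P) : Dominated m P P := ⟨hP, hP, fun _ _ => le_rfl⟩

lemma add (h : Dominated m P Q) (h' : Dominated m P' Q') : Dominated m (P + P') (Q + Q') :=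
  ⟨h.left.add h'.left, h.right.add h'.right, fun R hR => by
    rw [add_mul, add_mul, map_add, map_add]
    exact add_le_add (h.le R hR) (h'.le R hR)⟩

lemma mul (h : Dominated m P Q) (h' : Dominated m P' Q') : Dominated m (P * P') (Q * Q') :=
  ⟨h.left.mul h'.left, h.right.mul h'.right, fun R hR => by
    have h1 := h.le (P' * R) (h'.left.mul hR)
    have h2 := h'.le (Q * R) (h.right.mul hR)
    rw [mul_assoc, mul_assoc]
    refine h1.trans ?_
    rwa [mul_left_comm, mul_left_comm Q]⟩

lemma pow (h : Dominated m P Q) (k : ℕ) : Dominated m (P ^ k) (Q ^ k) := by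
  induction k with
  | zero => simpa using refl (NonnegCoeff.C zero_le_one)
  | succ k ih => rw [pow_succ, pow_succ]; exact ih.mul h

lemma sum {κ : Type*} {s : Finset κ} {P Q : κ → MvPolynomial ι ℝ}
    (h : ∀ i ∈ s, Dominated m (P i) (Q i)) : Dominated m (∑ i ∈ s, P i) (∑ i ∈ s, Q i) :=
  ⟨NonnegCoeff.sum fun i hi => (h i hi).left, NonnegCoeff.sum fun i hi => (h i hi).right,
    fun R hR => by
      rw [Finset.sum_mul, Finset.sum_mul, map_sum, map_sum]
      exact Finset.sum_le_sum fun i hi => (h i hi).le R hR⟩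

lemma prod {κ : Type*} {s : Finset κ} {P Q : κ → MvPolynomial ι ℝ}
    (h : ∀ i ∈ s, Dominated m (P i) (Q i)) : Dominated m (∏ i ∈ s, P i) (∏ i ∈ s, Q i) := by
  classical
  induction s using Finset.induction_on with
  | empty => simpa using refl (NonnegCoeff.C zero_le_one)
  | insert a s ha ih =>
    rw [Finset.prod_insert ha, Finset.prod_insert ha]
    exact (h a (by simp)).mul (ih fun i hi => h i (by simp [hi]))

lemma momentEval_le (h : Dominated m P Q) : momentEval m P ≤ momentEval m Q := by
  simpa using h.le 1 (by simpa using NonnegCoeff.C (ι := ι) zero_le_one)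

/-- By linearity it is enough to test against a monomial, where this is the association inequality
`m u i * m u j ≤ m u (i + j)`. Thus averaged factors in a majorant may be replaced by the variables
themselves. -/
lemma const (hm : IsMomentSeq m L) (u : ι) (i : ℕ) : Dominated m (C (m u i)) (X u ^ i) := by
  refine ⟨NonnegCoeff.C (hm.nonneg u i), (NonnegCoeff.X u).pow i, fun R hR => ?_⟩
  have hX : (X u ^ i : MvPolynomial ι ℝ) = monomial (Finsupp.single u i) 1 := X_pow_eq_monomial
  rw [mul_comm, mul_comm _ R, momentEval_mul_eq_sum, momentEval_mul_eq_sum]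
  refine Finset.sum_le_sum fun e _ => mul_le_mul_of_nonneg_left ?_ (hR e)
  rw [mul_comm, momentEval_C_mul, momentEval_monomial, hX, monomial_mul, momentEval_monomial,
    one_mul, one_mul, one_mul]
  have h1 := hm.momentProd_mul_le (Finsupp.single u i) e
  rw [add_comm] at h1
  refine le_trans (le_of_eq ?_) h1
  congr 1
  classical
  unfold momentProd
  rw [Finset.prod_eq_single u]
  · simp
  · intro b _ hb
    rw [Finsupp.single_eq_of_ne hb, hm.zero]
  · simp

end Dominated

/-- Integrating out the variable `v`. -/
noncomputable def condMoment {ι : Type*} (m : ι → ℕ → ℝ) (v : ι) :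
    MvPolynomial ι ℝ →ₗ[ℝ] MvPolynomial ι ℝ :=
  (basisMonomials ι ℝ).constr ℝ fun e => monomial (e.erase v) (m v (e v))

lemma condMoment_monomial {ι : Type*} {m : ι → ℕ → ℝ} (v : ι) (e : ι →₀ ℕ) (c : ℝ) :
    condMoment m v (monomial e c) = monomial (e.erase v) (c * m v (e v)) := by
  have h1 : monomial e c = c • monomial e (1 : ℝ) := by rw [smul_monomial]; simp
  have h2 : condMoment m v (monomial e (1 : ℝ)) = monomial (e.erase v) (m v (e v)) := by
    have := (basisMonomials ι ℝ).constr_basis ℝ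
      (fun e => monomial (e.erase v) (m v (e v)) : (ι →₀ ℕ) → MvPolynomial ι ℝ) e
    rwa [coe_basisMonomials] at this
  rw [h1, map_smul, h2, smul_monomial, smul_eq_mul]

lemma condMoment_eq_sum {ι : Type*} {m : ι → ℕ → ℝ} (v : ι) (P : MvPolynomial ι ℝ) :
    condMoment m v P = ∑ e ∈ P.support, monomial (e.erase v) (P.coeff e * m v (e v)) := by
  conv_lhs => rw [P.as_sum, map_sum]
  exact Finset.sum_congr rfl fun e _ => condMoment_monomial v e _

lemma momentProd_add_erase [DecidableEq ι] (v : ι) (a e : ι →₀ ℕ) :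
    m v (e v) * momentProd m (a + e.erase v) = m v (a v) * momentProd m (a.erase v + e) := by
  unfold momentProd
  rw [← Finset.mul_prod_erase _ _ (Finset.mem_univ v),
    ← Finset.mul_prod_erase (a := v) _ (fun u => m u ((a.erase v + e) u)) (Finset.mem_univ v)]
  have : ∏ u ∈ Finset.univ.erase v, m u ((a + e.erase v) u)
      = ∏ u ∈ Finset.univ.erase v, m u ((a.erase v + e) u) := by
    refine Finset.prod_congr rfl fun u hu => ?_
    simp [Finsupp.erase_ne (Finset.ne_of_mem_erase hu)]
  rw [this]
  simp only [Finsupp.add_apply, Finsupp.erase_same, add_zero, zero_add]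
  ring

/-- Once the variable `v` is integrated out of `P`, it occurs only in the tilt, and its moment `m v
(a v)` factors off. So `P` sees only the tilt `a.erase v`. -/
lemma momentEval_monomial_mul_condMoment (v : ι) (a : ι →₀ ℕ) (P : MvPolynomial ι ℝ) :
    momentEval m (monomial a 1 * condMoment m v P)
      = m v (a v) * momentEval m (monomial (a.erase v) 1 * P) := by
  induction P using MvPolynomial.induction_on' with
  | monomial e c =>
    rw [condMoment_monomial, monomial_mul, monomial_mul, momentEval_monomial, momentEval_monomial]
    classical
    have := momentProd_add_erase (m := m) v a e
    linear_combination c * this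
  | add p q hp hq =>
    rw [map_add, mul_add, mul_add, map_add, map_add, hp, hq, mul_add]

lemma NonnegCoeff.condMoment {ι : Type*} {m : ι → ℕ → ℝ} (hm : IsMomentSeq m L) (v : ι) {P : MvPolynomial ι ℝ}
    (hP : NonnegCoeff P) : NonnegCoeff (condMoment m v P) := by
  rw [condMoment_eq_sum]
  exact NonnegCoeff.sum fun e _ => NonnegCoeff.monomial _ (mul_nonneg (hP e) (hm.nonneg _ _))

lemma Dominated.condMoment (hm : IsMomentSeq m L) (v : ι) {P Q : MvPolynomial ι ℝ}
    (h : Dominated m P Q) : Dominated m (condMoment m v P) (condMoment m v Q) := by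
  refine ⟨h.left.condMoment hm v, h.right.condMoment hm v, fun R hR => ?_⟩
  rw [mul_comm, mul_comm _ R, momentEval_mul_eq_sum, momentEval_mul_eq_sum]
  refine Finset.sum_le_sum fun e _ => mul_le_mul_of_nonneg_left ?_ (hR e)
  rw [momentEval_monomial_mul_condMoment, momentEval_monomial_mul_condMoment]
  refine mul_le_mul_of_nonneg_left ?_ (hm.nonneg _ _)
  rw [mul_comm, mul_comm _ Q]
  exact h.le _ (NonnegCoeff.monomial _ zero_le_one)

end Functional

/-! ### Size bookkeeping for exponent vectors -/

section Small

variable {ι : Type*} {q Γ N N' : ℕ} {a b : ι →₀ ℕ}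

lemma IsSmall.mono (ha : IsSmall q Γ N a) (h : N ≤ N') : IsSmall q Γ N' a :=
  ⟨ha.1.trans (Nat.mul_le_mul_left q h), fun u => (ha.2 u).trans (Nat.mul_le_mul_left Γ h)⟩

lemma IsSmall.add (ha : IsSmall q Γ N a) (hb : IsSmall q Γ N' b) :
    IsSmall q Γ (N + N') (a + b) := by
  refine ⟨?_, fun u => ?_⟩
  · rw [map_add, mul_add]; exact add_le_add ha.1 hb.1
  · rw [Finsupp.add_apply, mul_add]; exact add_le_add (ha.2 u) (hb.2 u)

lemma IsSmall.zero : IsSmall q Γ 0 (0 : ι →₀ ℕ) := by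
  simp [IsSmall]

lemma IsSmall.erase [Fintype ι] (ha : IsSmall q Γ N a) (v : ι) : IsSmall q Γ N (a.erase v) := by
  classical
  have h : ∀ u, a.erase v u ≤ a u := fun u => by rw [Finsupp.erase_apply]; split_ifs <;> simp
  refine ⟨le_trans ?_ ha.1, fun u => (h u).trans (ha.2 u)⟩
  rw [Finsupp.degree_eq_sum, Finsupp.degree_eq_sum]
  exact Finset.sum_le_sum fun u _ => h u

/-- Polynomials all of whose exponent vectors are small. -/
def SmallSupport (q Γ N : ℕ) (P : MvPolynomial ι ℝ) : Prop := ∀ e ∈ P.support, IsSmall q Γ N e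

namespace SmallSupport

variable {P Q : MvPolynomial ι ℝ}

lemma monomial {e : ι →₀ ℕ} (c : ℝ) (he : IsSmall q Γ N e) :
    SmallSupport q Γ N (MvPolynomial.monomial e c) := by
  intro e' he'
  have := MvPolynomial.support_monomial_subset he'
  rw [Finset.mem_singleton] at this
  rwa [this]

lemma sum {κ : Type*} {s : Finset κ} {P : κ → MvPolynomial ι ℝ}
    (hP : ∀ i ∈ s, SmallSupport q Γ N (P i)) : SmallSupport q Γ N (∑ i ∈ s, P i) := by
  classical
  intro e he
  obtain ⟨i, hi, he'⟩ := Finset.mem_biUnion.1 (MvPolynomial.support_sum he)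
  exact hP i hi e he'

lemma mul (hP : SmallSupport q Γ N P) (hQ : SmallSupport q Γ N' Q) :
    SmallSupport q Γ (N + N') (P * Q) := by
  classical
  intro e he
  obtain ⟨x, hx, y, hy, rfl⟩ := Finset.mem_add.1 (MvPolynomial.support_mul _ _ he)
  exact (hP x hx).add (hQ y hy)

lemma pow (hP : SmallSupport q Γ 1 P) (k : ℕ) : SmallSupport q Γ k (P ^ k) := by
  induction k with
  | zero => exact monomial 1 IsSmall.zero
  | succ k ih => rw [pow_succ]; exact ih.mul hP

lemma condMoment [Fintype ι] {m : ι → ℕ → ℝ} (v : ι) (hP : SmallSupport q Γ N P) :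
    SmallSupport q Γ N (condMoment m v P) := by
  rw [condMoment_eq_sum]
  exact sum fun e he => monomial _ ((hP e he).erase v)

end SmallSupport

end Small

/-! ### Powers by successive tilting -/

section Power

open MvPolynomial

variable {ι : Type*} [Fintype ι] {m : ι → ℕ → ℝ} {L : ℝ}

/-- A polynomial whose expectation is at most `B` under every tilt by a small exponent vector has
moments at most `B ^ p`. -/
lemma momentEval_monomial_mul_pow_le {q Γ l K : ℕ} {F : MvPolynomial ι ℝ}
    (hF : NonnegCoeff F) (hFs : SmallSupport q Γ l F) {B : ℝ} (hB : 0 ≤ B)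
    (hstep : ∀ N (a : ι →₀ ℕ), IsSmall q Γ N a → N + l ≤ K →
      momentEval m (monomial a 1 * F) ≤ B * momentProd m a)
    (p N : ℕ) (a : ι →₀ ℕ) (ha : IsSmall q Γ N a) (hN : N + p * l ≤ K) :
    momentEval m (monomial a 1 * F ^ p) ≤ B ^ p * momentProd m a := by
  induction p generalizing N a with
  | zero => simp [momentEval_monomial]
  | succ p ih =>
    have hl : N + l + p * l ≤ K := by rw [Nat.succ_mul] at hN; omega
    -- Expand one factor `F`: each of its monomials `e` moves the tilt from `a` to `a + e`, which is
    -- still small, so induction handles the other `p` factors. Then `hstep` bounds the sum over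
    -- `e`.
    have e1 : monomial a (1 : ℝ) * F ^ (p + 1) = F * (monomial a 1 * F ^ p) := by ring
    have e2 : monomial a (1 : ℝ) * F = F * (monomial a 1 * 1) := by ring
    have h1 := hstep N a ha (by omega)
    rw [e2, momentEval_mul_eq_sum] at h1
    rw [e1, momentEval_mul_eq_sum]
    have h2 : ∀ e ∈ F.support, F.coeff e * momentEval m (monomial e 1 * (monomial a 1 * F ^ p))
        ≤ B ^ p * (F.coeff e * momentEval m (monomial e 1 * (monomial a 1 * 1))) := by
      intro e he
      have h3 := ih (N + l) (a + e) (ha.add (hFs e he)) hl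
      have e3 : monomial e (1 : ℝ) * (monomial a 1 * F ^ p) = monomial (a + e) 1 * F ^ p := by
        rw [← mul_assoc, monomial_mul, one_mul, add_comm]
      have e4 : monomial e (1 : ℝ) * (monomial a 1 * 1) = monomial (a + e) 1 := by
        rw [mul_one, monomial_mul, one_mul, add_comm]
      rw [e3, e4, momentEval_monomial, one_mul]
      calc _ ≤ F.coeff e * (B ^ p * momentProd m (a + e)) :=
            mul_le_mul_of_nonneg_left h3 (hF e)
        _ = _ := by ring
    refine (Finset.sum_le_sum h2).trans ?_
    rw [← Finset.mul_sum, pow_succ, mul_assoc]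
    exact mul_le_mul_of_nonneg_left h1 (pow_nonneg hB p)

end Power

/-! ### Clusters of monomials sharing a vertex -/

section Cluster

open MvPolynomial

variable {ι : Type*} [Fintype ι] {m : ι → ℕ → ℝ} {L : ℝ}
  {S : Finset (ι →₀ ℕ)} {w : (ι →₀ ℕ) → ℝ} {q Γ K : ℕ} {T T' : ℝ}

/-- The part of a polynomial whose monomials contain `v`. -/
noncomputable def linkPoly (S : Finset (ι →₀ ℕ)) (w : (ι →₀ ℕ) → ℝ) (v : ι) :
    MvPolynomial ι ℝ :=
  ∑ h ∈ S with h v ≠ 0, monomial h (w h)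

/-- Clusters of `j` monomials sharing a vertex, which is integrated out. -/
noncomputable def clusterPoly (m : ι → ℕ → ℝ) (S : Finset (ι →₀ ℕ)) (w : (ι →₀ ℕ) → ℝ) (j : ℕ) :
    MvPolynomial ι ℝ :=
  ∑ v, condMoment m v (linkPoly S w v ^ j)

lemma momentEval_mul_linkPoly (v : ι) (R : MvPolynomial ι ℝ) (a : ι →₀ ℕ) :
    momentEval m (monomial a 1 * (linkPoly S w v * R))
      = ∑ h ∈ S with h v ≠ 0, w h * momentEval m (monomial (a + h) 1 * R) := by
  unfold linkPoly
  rw [Finset.sum_mul, Finset.mul_sum, map_sum]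
  refine Finset.sum_congr rfl fun h _ => ?_
  rw [← mul_assoc, monomial_mul, one_mul, ← momentEval_C_mul, ← mul_assoc, C_mul_monomial, mul_one]

/-- Each monomial is counted once per vertex, and it has at most `q` vertices. -/
lemma sum_sum_containing_le (hq : ∀ h ∈ S, h.degree ≤ q) (f : (ι →₀ ℕ) → ℝ)
    (hf : ∀ h, 0 ≤ f h) (p : (ι →₀ ℕ) → Prop) [DecidablePred p] :
    ∑ v, ∑ h ∈ S with h v ≠ 0 ∧ p h, f h ≤ q * ∑ h ∈ S with p h, f h := by
  simp only [and_comm (b := p _), ← Finset.filter_filter]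
  simp_rw [Finset.sum_filter (fun h : ι →₀ ℕ => h _ ≠ 0)]
  rw [Finset.sum_comm, Finset.mul_sum]
  refine Finset.sum_le_sum fun h hh => ?_
  rw [← Finset.sum_filter, Finset.sum_const, nsmul_eq_mul]
  refine mul_le_mul_of_nonneg_right ?_ (hf h)
  have h1 : (Finset.univ.filter fun v => h v ≠ 0).card ≤ h.degree := by
    rw [Finsupp.degree_eq_sum, Finset.card_eq_sum_ones, Finset.sum_filter]
    refine Finset.sum_le_sum fun v _ => ?_
    split_ifs with hv
    · exact Nat.one_le_iff_ne_zero.2 hv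
    · exact Nat.zero_le _
  exact_mod_cast h1.trans (hq h (Finset.mem_filter.1 hh).1)

variable [DecidableEq ι]

lemma IsSmooth.isSmall (hs : IsSmooth m L S w q Γ K T) {h : ι →₀ ℕ} (hh : h ∈ S) :
    IsSmall q Γ 1 h :=
  ⟨by simpa using hs.degree_le h hh, fun u => by simpa using hs.power_le h hh u⟩

lemma IsSmooth.linkPoly_nonneg (hs : IsSmooth m L S w q Γ K T) (v : ι) :
    NonnegCoeff (linkPoly S w v) :=
  NonnegCoeff.sum fun h _ => NonnegCoeff.monomial h (hs.weight_nonneg h)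

lemma IsSmooth.linkPoly_small (hs : IsSmooth m L S w q Γ K T) (v : ι) :
    SmallSupport q Γ 1 (linkPoly S w v) :=
  SmallSupport.sum fun _ hh => SmallSupport.monomial _ (hs.isSmall (Finset.mem_filter.1 hh).1)

lemma IsSmooth.clusterPoly_nonneg (hs : IsSmooth m L S w q Γ K T) (j : ℕ) :
    NonnegCoeff (clusterPoly m S w j) :=
  NonnegCoeff.sum fun v _ => ((hs.linkPoly_nonneg v).pow j).condMoment hs.momentSeq v

lemma IsSmooth.clusterPoly_small (hs : IsSmooth m L S w q Γ K T) (j : ℕ) :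
    SmallSupport q Γ j (clusterPoly m S w j) :=
  SmallSupport.sum fun v _ => ((hs.linkPoly_small v).pow j).condMoment v

/-- Choosing another monomial through `v` costs `T * exp q * i / K` and raises the bound on the tilt
at `v` from `Γ * i` to `Γ * (i + 1)`. The successive factors `i, i + 1, …` form the rising
factorial. -/
lemma IsSmooth.momentEval_mul_linkPoly_pow_le (hs : IsSmooth m L S w q Γ K T) {v : ι} (l : ℕ) :
    ∀ (i N : ℕ) (a : ι →₀ ℕ), IsSmall q Γ N a → N + l ≤ K → a v ≠ 0 → a v ≤ Γ * i →
      momentEval m (monomial a 1 * linkPoly S w v ^ l)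
        ≤ (T * Real.exp q / K) ^ l * (i.ascFactorial l : ℝ) * momentProd m a := by
  have hT := hs.T_nonneg
  induction l with
  | zero => intro i N a _ _ _ _; simp [momentEval_monomial]
  | succ l ih =>
    intro i N a ha hN hv hi
    rw [pow_succ', momentEval_mul_linkPoly]
    have h1 : ∀ h ∈ S.filter (fun h => h v ≠ 0),
        w h * momentEval m (monomial (a + h) 1 * linkPoly S w v ^ l)
          ≤ ((T * Real.exp q / K) ^ l * ((i + 1).ascFactorial l : ℝ)) *
            (w h * momentProd m (a + h)) := by
      intro h hh
      have hhS := (Finset.mem_filter.1 hh).1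
      have h2 := ih (i + 1) (N + 1) (a + h) (ha.add (hs.isSmall hhS)) (by omega)
        (by simp [hv]) (by
          rw [Finsupp.add_apply, mul_add, mul_one]
          exact add_le_add hi (hs.power_le h hhS v))
      calc _ ≤ w h * ((T * Real.exp q / K) ^ l * ((i + 1).ascFactorial l : ℝ) *
              momentProd m (a + h)) := mul_le_mul_of_nonneg_left h2 (hs.weight_nonneg h)
        _ = _ := by ring
    refine (Finset.sum_le_sum h1).trans ?_
    rw [← Finset.mul_sum]
    have h3 := hs.sum_containing_le (ha.mono (by omega : N ≤ K)) hv hi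
    refine (mul_le_mul_of_nonneg_left h3 (by positivity)).trans (le_of_eq ?_)
    have h4 : (i.ascFactorial (l + 1) : ℝ) = i * ((i + 1).ascFactorial l : ℝ) := by
      exact_mod_cast (Nat.ascFactorial_succ (n := i) (k := l)).trans
        (Nat.succ_ascFactorial i l).symm
    rw [h4, pow_succ]
    ring

/-- Pairs of monomials sharing a vertex `v` outside of the support of `a`. -/
lemma IsSmooth.sum_pairs_le (hs : IsSmooth m L S w q Γ K T) (hs' : IsSmooth m L S w q Γ 1 T')
    {v : ι} {N : ℕ} {a : ι →₀ ℕ} (ha : IsSmall q Γ N a) (hN : N + 1 ≤ K) (hv : a v = 0) :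
    ∑ h ∈ S with h v ≠ 0, ∑ h' ∈ S with h' v ≠ 0, w h * (w h' * momentProd m (a + h + h'))
      ≤ 2 * (T * Real.exp q / K) * ∑ h ∈ S with h v ≠ 0 ∧ ∃ u ∈ a.support, h u ≠ 0,
          w h * momentProd m (a + h)
        + T' * Real.exp q * momentProd m a * ∑ h ∈ S with h v ≠ 0, w h * momentProd m h := by
  have hw := hs.weight_nonneg
  have hmm := hs.momentSeq.momentProd_nonneg
  set Sv := S.filter (fun h => h v ≠ 0) with hSv
  set hit : (ι →₀ ℕ) → Prop := fun h => ∃ u ∈ a.support, h u ≠ 0 with hhit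
  -- After `h` is chosen, the tilt at `v` is positive and at most `Γ`, so `i = 1` and the second
  -- monomial costs `1 / K`.
  have hforce : ∀ h ∈ Sv, ∑ h' ∈ Sv, w h' * momentProd m (a + h + h')
      ≤ T * Real.exp q / K * momentProd m (a + h) := by
    intro h hh
    obtain ⟨hhS, hhv⟩ := Finset.mem_filter.1 hh
    have := hs.sum_containing_le (a := a + h) (v := v) (i := 1)
      ((ha.add (hs.isSmall hhS)).mono hN) (by simp [hhv])
      (by simpa [hv] using hs.power_le h hhS v)
    refine this.trans (le_of_eq ?_)
    push_cast; ring
  -- Here the tilt is the single monomial `h`, so scale `1` is enough and the constant is `T'`.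
  have hfree : ∀ h ∈ Sv, ∑ h' ∈ Sv, w h' * momentProd m (h + h')
      ≤ T' * Real.exp q * momentProd m h := by
    intro h hh
    obtain ⟨hhS, hhv⟩ := Finset.mem_filter.1 hh
    have := hs'.sum_containing_le (a := h) (v := v) (i := 1) (hs.isSmall hhS) hhv
      (by simpa using hs.power_le h hhS v)
    refine this.trans (le_of_eq ?_)
    push_cast; ring
  -- Either one of the two monomials meets `a`, or both avoid it and the expectation factorizes.
  have hsplit : ∀ h h', w h * (w h' * momentProd m (a + h + h'))
      ≤ (if hit h then w h * (w h' * momentProd m (a + h + h')) else 0)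
        + (if hit h' then w h' * (w h * momentProd m (a + h' + h)) else 0)
        + momentProd m a * (w h * (w h' * momentProd m (h + h'))) := by
    intro h h'
    have p1 : 0 ≤ w h * (w h' * momentProd m (a + h + h')) :=
      mul_nonneg (hw _) (mul_nonneg (hw _) (hmm _))
    have p2 : 0 ≤ momentProd m a * (w h * (w h' * momentProd m (h + h'))) :=
      mul_nonneg (hmm _) (mul_nonneg (hw _) (mul_nonneg (hw _) (hmm _)))
    have p3 : w h' * (w h * momentProd m (a + h' + h))
        = w h * (w h' * momentProd m (a + h + h')) := by
      rw [add_right_comm]; ring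
    rw [p3]
    by_cases c1 : hit h
    · rw [if_pos c1]
      split_ifs <;> linarith
    by_cases c2 : hit h'
    · rw [if_pos c2, if_neg c1]; linarith
    rw [if_neg c1, if_neg c2]
    have e : momentProd m (a + h + h') = momentProd m a * momentProd m (h + h') := by
      unfold momentProd
      rw [← Finset.prod_mul_distrib]
      refine Finset.prod_congr rfl fun u _ => ?_
      by_cases hu : a u = 0
      · simp [hu, hs.momentSeq.zero]
      · have hu' : u ∈ a.support := Finsupp.mem_support_iff.2 hu
        have z1 : h u = 0 := by
          by_contra hne; exact c1 ⟨u, hu', hne⟩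
        have z2 : h' u = 0 := by
          by_contra hne; exact c2 ⟨u, hu', hne⟩
        simp [z1, z2, hs.momentSeq.zero]
    rw [e]
    linarith
  have hhitsum : ∑ h ∈ Sv, ∑ h' ∈ Sv,
      (if hit h then w h * (w h' * momentProd m (a + h + h')) else 0)
        ≤ T * Real.exp q / K * ∑ h ∈ S with h v ≠ 0 ∧ hit h, w h * momentProd m (a + h) := by
    have e : ∑ h ∈ S with h v ≠ 0 ∧ hit h, w h * momentProd m (a + h)
        = ∑ h ∈ Sv, if hit h then w h * momentProd m (a + h) else 0 := by
      rw [← Finset.filter_filter, Finset.sum_filter]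
    rw [e, Finset.mul_sum]
    refine Finset.sum_le_sum fun h hh => ?_
    split_ifs
    · rw [← Finset.mul_sum]
      calc _ ≤ w h * (T * Real.exp q / K * momentProd m (a + h)) :=
            mul_le_mul_of_nonneg_left (hforce h hh) (hw h)
        _ = _ := by ring
    · simp
  have hfreesum : ∑ h ∈ Sv, ∑ h' ∈ Sv, momentProd m a * (w h * (w h' * momentProd m (h + h')))
      ≤ T' * Real.exp q * momentProd m a * ∑ h ∈ Sv, w h * momentProd m h := by
    rw [Finset.mul_sum]
    refine Finset.sum_le_sum fun h hh => ?_
    rw [← Finset.mul_sum, ← Finset.mul_sum]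
    calc _ ≤ momentProd m a * (w h * (T' * Real.exp q * momentProd m h)) :=
          mul_le_mul_of_nonneg_left (mul_le_mul_of_nonneg_left (hfree h hh) (hw h)) (hmm a)
      _ = _ := by ring
  have hhitsum' : ∑ h ∈ Sv, ∑ h' ∈ Sv,
      (if hit h' then w h' * (w h * momentProd m (a + h' + h)) else 0)
        ≤ T * Real.exp q / K * ∑ h ∈ S with h v ≠ 0 ∧ hit h, w h * momentProd m (a + h) := by
    rw [Finset.sum_comm]
    exact hhitsum
  calc ∑ h ∈ Sv, ∑ h' ∈ Sv, w h * (w h' * momentProd m (a + h + h'))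
      ≤ ∑ h ∈ Sv, ∑ h' ∈ Sv,
          ((if hit h then w h * (w h' * momentProd m (a + h + h')) else 0)
            + (if hit h' then w h' * (w h * momentProd m (a + h' + h)) else 0)
            + momentProd m a * (w h * (w h' * momentProd m (h + h')))) :=
        Finset.sum_le_sum fun h _ => Finset.sum_le_sum fun h' _ => hsplit h h'
    _ ≤ _ := by
        simp only [Finset.sum_add_distrib]
        linarith

/-- The first two monomials through `v` are handled by `sum_pairs_le`, the other `l` are forced
through `v`, and summing over `v` costs a factor `q`. Integrating out `v` removes `v` from the tilt;
association restores it afterwards. -/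
lemma IsSmooth.momentEval_mul_clusterPoly_le (hs : IsSmooth m L S w q Γ K T)
    (hs' : IsSmooth m L S w q Γ 1 T') {N l : ℕ} {a : ι →₀ ℕ} (ha : IsSmall q Γ N a)
    (hN : N + (l + 2) ≤ K) :
    momentEval m (monomial a 1 * clusterPoly m S w (l + 2))
      ≤ (T * Real.exp q / K) ^ l * ((l + 1).factorial : ℝ) *
        (q * (2 * (T * Real.exp q / K) * (T * Real.exp q)
          + T' * Real.exp q * ∑ h ∈ S, w h * momentProd m h)) * momentProd m a := by
  have hw := hs.weight_nonneg
  have hmm := hs.momentSeq.momentProd_nonneg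
  have hT := hs.T_nonneg
  have hT' := hs'.T_nonneg
  have hms := hs.momentSeq
  have hmv : ∀ v, m v (a v) * momentProd m (a.erase v) = momentProd m a := by
    intro v
    have := momentProd_add_erase (m := m) v a 0
    simpa [hms.zero] using this.symm
  have hmv' : ∀ v h, m v (a v) * momentProd m (a.erase v + h) ≤ momentProd m (a + h) := by
    intro v h
    rw [← momentProd_add_erase]
    unfold momentProd
    rw [← Finset.mul_prod_erase _ _ (Finset.mem_univ v),
      ← Finset.mul_prod_erase (a := v) _ (fun u => m u ((a + h) u)) (Finset.mem_univ v)]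
    have e : ∏ u ∈ Finset.univ.erase v, m u ((a + h.erase v) u)
        = ∏ u ∈ Finset.univ.erase v, m u ((a + h) u) := by
      refine Finset.prod_congr rfl fun u hu => ?_
      simp [Finsupp.erase_ne (Finset.ne_of_mem_erase hu)]
    rw [e, ← mul_assoc]
    refine mul_le_mul_of_nonneg_right ?_ (Finset.prod_nonneg fun u _ => hms.nonneg u _)
    have := hms.mul_le v (a v) (h v)
    simpa [mul_comm] using this
  set c : ℝ := (T * Real.exp q / K) ^ l * ((l + 1).factorial : ℝ) with hc
  have hc0 : 0 ≤ c := by positivity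
  have hone : ∀ v, momentEval m (monomial a 1 * condMoment m v (linkPoly S w v ^ (l + 2)))
      ≤ c * (2 * (T * Real.exp q / K) *
          (∑ h ∈ S with h v ≠ 0 ∧ ∃ u ∈ a.support, h u ≠ 0, w h * momentProd m (a + h))
        + T' * Real.exp q * momentProd m a *
          ∑ h ∈ S with h v ≠ 0 ∧ True, w h * momentProd m h) := by
    intro v
    rw [momentEval_monomial_mul_condMoment, pow_succ', pow_succ', momentEval_mul_linkPoly]
    simp_rw [momentEval_mul_linkPoly]
    have h1 : ∀ h ∈ S.filter (fun h => h v ≠ 0), ∀ h' ∈ S.filter (fun h => h v ≠ 0),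
        momentEval m (monomial (a.erase v + h + h') 1 * linkPoly S w v ^ l)
          ≤ c * momentProd m (a.erase v + h + h') := by
      intro h hh h' hh'
      obtain ⟨hhS, hhv⟩ := Finset.mem_filter.1 hh
      obtain ⟨hhS', hhv'⟩ := Finset.mem_filter.1 hh'
      -- Two monomials through `v` make the power at `v` at most `2 * Γ`, so the rising factorial
      -- starts at `2` and equals `(l + 1)!`.
      have h2 := hs.momentEval_mul_linkPoly_pow_le (v := v) l 2 (N + 1 + 1) (a.erase v + h + h')
        (((ha.erase v).add (hs.isSmall hhS)).add (hs.isSmall hhS')) (by omega) (by simp [hhv])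
        (by
          have := hs.power_le h hhS v
          have := hs.power_le h' hhS' v
          simp only [Finsupp.add_apply, Finsupp.erase_same]
          omega)
      have h3 : Nat.ascFactorial 2 l = (l + 1).factorial := by
        have := Nat.factorial_mul_ascFactorial 1 l
        simpa [add_comm] using this
      rwa [h3] at h2
    have h2 : ∑ h ∈ S with h v ≠ 0, w h * ∑ h' ∈ S with h' v ≠ 0,
          w h' * momentEval m (monomial (a.erase v + h + h') 1 * linkPoly S w v ^ l)
        ≤ c * ∑ h ∈ S with h v ≠ 0, ∑ h' ∈ S with h' v ≠ 0,
          w h * (w h' * momentProd m (a.erase v + h + h')) := by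
      rw [Finset.mul_sum]
      refine Finset.sum_le_sum fun h hh => ?_
      rw [Finset.mul_sum, Finset.mul_sum]
      refine Finset.sum_le_sum fun h' hh' => ?_
      calc _ ≤ w h * (w h' * (c * momentProd m (a.erase v + h + h'))) :=
            mul_le_mul_of_nonneg_left (mul_le_mul_of_nonneg_left (h1 h hh h' hh') (hw h')) (hw h)
        _ = _ := by ring
    have h3 := hs.sum_pairs_le hs' (v := v) (ha.erase v) (by omega) (by simp)
    have h4 : m v (a v) * ∑ h ∈ S with h v ≠ 0 ∧ ∃ u ∈ (a.erase v).support, h u ≠ 0,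
          w h * momentProd m (a.erase v + h)
        ≤ ∑ h ∈ S with h v ≠ 0 ∧ ∃ u ∈ a.support, h u ≠ 0, w h * momentProd m (a + h) := by
      rw [Finset.mul_sum]
      refine le_trans (Finset.sum_le_sum fun h _ => (?_ : _ ≤ w h * momentProd m (a + h))) ?_
      · have := mul_le_mul_of_nonneg_left (hmv' v h) (hw h)
        linarith
      · refine Finset.sum_le_sum_of_subset_of_nonneg ?_ fun h _ _ => mul_nonneg (hw h) (hmm _)
        intro h hh
        obtain ⟨hhS, hhv, u, hu, hu'⟩ := Finset.mem_filter.1 hh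
        refine Finset.mem_filter.2 ⟨hhS, hhv, u, ?_, hu'⟩
        rw [Finsupp.support_erase] at hu
        exact Finset.mem_of_mem_erase hu
    have h5 := mul_le_mul_of_nonneg_left (h2.trans (mul_le_mul_of_nonneg_left h3 hc0))
      (hms.nonneg v (a v))
    refine h5.trans ?_
    have h6 := mul_le_mul_of_nonneg_left h4
      (by positivity : 0 ≤ c * (2 * (T * Real.exp q / K)))
    have h7 := hmv v
    simp only [and_true]
    calc _ = c * (2 * (T * Real.exp q / K)) * (m v (a v) *
              ∑ h ∈ S with h v ≠ 0 ∧ ∃ u ∈ (a.erase v).support, h u ≠ 0,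
                w h * momentProd m (a.erase v + h))
            + c * (T' * Real.exp q * (m v (a v) * momentProd m (a.erase v)) *
              ∑ h ∈ S with h v ≠ 0, w h * momentProd m h) := by ring
      _ ≤ _ := by rw [h7]; linarith
  unfold clusterPoly
  rw [Finset.mul_sum, map_sum]
  refine (Finset.sum_le_sum fun v _ => hone v).trans ?_
  rw [← Finset.mul_sum, Finset.sum_add_distrib, ← Finset.mul_sum, ← Finset.mul_sum]
  have s1 := sum_sum_containing_le (S := S) hs.degree_le (fun h => w h * momentProd m (a + h))
    (fun h => mul_nonneg (hw h) (hmm _)) (fun h => ∃ u ∈ a.support, h u ≠ 0)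
  have s2 := sum_sum_containing_le (S := S) hs.degree_le (fun h => w h * momentProd m h)
    (fun h => mul_nonneg (hw h) (hmm _)) (fun _ => True)
  rw [Finset.filter_true] at s2
  have s3 := hs.sum_meeting_le (ha.mono (by omega : N ≤ K))
  have s4 : ∑ v, ∑ h ∈ S with h v ≠ 0 ∧ ∃ u ∈ a.support, h u ≠ 0, w h * momentProd m (a + h)
      ≤ q * (T * Real.exp q * momentProd m a) :=
    s1.trans (mul_le_mul_of_nonneg_left s3 (Nat.cast_nonneg q))
  rw [mul_assoc c]
  refine mul_le_mul_of_nonneg_left ?_ hc0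
  have s5 := mul_le_mul_of_nonneg_left s4 (by positivity : 0 ≤ 2 * (T * Real.exp q / K))
  have s6 := mul_le_mul_of_nonneg_left s2
    (mul_nonneg (by positivity) (hmm a) : 0 ≤ T' * Real.exp q * momentProd m a)
  refine (add_le_add s5 s6).trans (le_of_eq ?_)
  ring

end Cluster

/-! ### Polynomially bounded functions, a class closed under the operations that need integrability
-/

section PolyBounded

open MvPolynomial

variable {ι : Type*}

/-- Measurable functions bounded by a polynomial in the absolute values of the coordinates. -/
def PolyBounded (F : (ι → ℝ) → ℝ) : Prop :=
  Measurable F ∧ ∃ P : MvPolynomial ι ℝ, ∀ y, |F y| ≤ eval (fun u => |y u|) P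

lemma measurable_eval_abs [Fintype ι] (P : MvPolynomial ι ℝ) :
    Measurable fun y : ι → ℝ => eval (fun u => |y u|) P :=
  ((MvPolynomial.continuous_eval P).comp (by fun_prop)).measurable

lemma NonnegCoeff.eval_nonneg [Fintype ι] {P : MvPolynomial ι ℝ} (hP : NonnegCoeff P) (y : ι → ℝ) :
    0 ≤ eval (fun u => |y u|) P := by
  rw [eval_eq']
  exact Finset.sum_nonneg fun e _ => mul_nonneg (hP e) (Finset.prod_nonneg fun u _ => by positivity)

namespace PolyBounded

variable {F G : (ι → ℝ) → ℝ}

lemma of_le (hF : Measurable F) (P : MvPolynomial ι ℝ)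
    (h : ∀ y, |F y| ≤ eval (fun u => |y u|) P) : PolyBounded F := ⟨hF, P, h⟩

lemma eval_abs [Fintype ι] {P : MvPolynomial ι ℝ} (hP : NonnegCoeff P) :
    PolyBounded fun y : ι → ℝ => eval (fun u => |y u|) P :=
  ⟨measurable_eval_abs P, P, fun y => (abs_of_nonneg (hP.eval_nonneg y)).le⟩

lemma add (hF : PolyBounded F) (hG : PolyBounded G) : PolyBounded fun y => F y + G y := by
  obtain ⟨hF, P, hP⟩ := hF
  obtain ⟨hG, Q, hQ⟩ := hG
  refine ⟨hF.add hG, P + Q, fun y => ?_⟩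
  rw [map_add]
  exact (abs_add_le _ _).trans (add_le_add (hP y) (hQ y))

lemma mul (hF : PolyBounded F) (hG : PolyBounded G) : PolyBounded fun y => F y * G y := by
  obtain ⟨hF, P, hP⟩ := hF
  obtain ⟨hG, Q, hQ⟩ := hG
  refine ⟨hF.mul hG, P * Q, fun y => ?_⟩
  rw [map_mul, abs_mul]
  exact mul_le_mul (hP y) (hQ y) (abs_nonneg _) ((abs_nonneg _).trans (hP y))

lemma const (c : ℝ) : PolyBounded fun _ : ι → ℝ => c :=
  ⟨measurable_const, C |c|, fun y => by simp⟩

lemma neg (hF : PolyBounded F) : PolyBounded fun y => - F y := by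
  simpa using (const (ι := ι) (-1)).mul hF

lemma sub (hF : PolyBounded F) (hG : PolyBounded G) : PolyBounded fun y => F y - G y := by
  simpa [sub_eq_add_neg] using hF.add hG.neg

lemma abs (hF : PolyBounded F) : PolyBounded fun y => |F y| := by
  obtain ⟨hF, P, hP⟩ := hF
  exact ⟨measurable_abs.comp hF, P, fun y => by simpa using hP y⟩

lemma pow (hF : PolyBounded F) (k : ℕ) : PolyBounded fun y => F y ^ k := by
  induction k with
  | zero => simpa using const (ι := ι) 1
  | succ k ih => simpa only [pow_succ] using ih.mul hF

lemma sum {κ : Type*} {s : Finset κ} {F : κ → (ι → ℝ) → ℝ} (hF : ∀ i ∈ s, PolyBounded (F i)) :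
    PolyBounded fun y => ∑ i ∈ s, F i y := by
  classical
  induction s using Finset.induction_on with
  | empty => simpa using const (ι := ι) 0
  | insert a s ha ih =>
    simp only [Finset.sum_insert ha]
    exact (hF a (by simp)).add (ih fun i hi => hF i (by simp [hi]))

lemma prod {κ : Type*} {s : Finset κ} {F : κ → (ι → ℝ) → ℝ} (hF : ∀ i ∈ s, PolyBounded (F i)) :
    PolyBounded fun y => ∏ i ∈ s, F i y := by
  classical
  induction s using Finset.induction_on with
  | empty => simpa using const (ι := ι) 1
  | insert a s ha ih =>
    simp only [Finset.prod_insert ha]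
    exact (hF a (by simp)).mul (ih fun i hi => hF i (by simp [hi]))

lemma coord (u : ι) : PolyBounded fun y : ι → ℝ => y u :=
  ⟨measurable_pi_apply u, X u, fun y => by simp⟩

end PolyBounded

end PolyBounded

/-! ### Integration against a product of laws, one coordinate at a time -/

section Product

open MvPolynomial

variable {ι : Type*} [Fintype ι] {ν : ι → Measure ℝ}

/-- The absolute moments of a family of laws on the line. -/
noncomputable def absMoment {ι : Type*} (ν : ι → Measure ℝ) (u : ι) (i : ℕ) : ℝ :=
  ∫ t, |t| ^ i ∂ν u

lemma slice_eval_abs [DecidableEq ι] (hν : ∀ u i, Integrable (fun t => |t| ^ i) (ν u)) (v : ι) (y : ι → ℝ)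
    (P : MvPolynomial ι ℝ) :
    Integrable (fun t => eval (fun u => |Function.update y v t u|) P) (ν v) ∧
      ∫ t, eval (fun u => |Function.update y v t u|) P ∂ν v
        = eval (fun u => |y u|) (condMoment (absMoment ν) v P) := by
  induction P using MvPolynomial.induction_on' with
  | monomial e c =>
    have h1 : ∀ t, eval (fun u => |Function.update y v t u|) (monomial e c)
        = (c * ∏ u ∈ Finset.univ.erase v, |y u| ^ e u) * |t| ^ e v := by
      intro t
      rw [eval_monomial, Finsupp.prod_fintype _ _ (fun _ => pow_zero _),
        ← Finset.mul_prod_erase _ _ (Finset.mem_univ v)]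
      have : ∏ u ∈ Finset.univ.erase v, |Function.update y v t u| ^ e u
          = ∏ u ∈ Finset.univ.erase v, |y u| ^ e u :=
        Finset.prod_congr rfl fun u hu => by
          rw [Function.update_of_ne (Finset.ne_of_mem_erase hu)]
      rw [this, Function.update_self]; ring
    simp only [h1]
    refine ⟨(hν v _).const_mul _, ?_⟩
    rw [integral_const_mul, condMoment_monomial, eval_monomial,
      Finsupp.prod_fintype _ _ (fun _ => pow_zero _),
      ← Finset.mul_prod_erase _ (fun u => |y u| ^ (e.erase v) u) (Finset.mem_univ v)]
    have : ∏ u ∈ Finset.univ.erase v, |y u| ^ (e.erase v) u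
        = ∏ u ∈ Finset.univ.erase v, |y u| ^ e u :=
      Finset.prod_congr rfl fun u hu => by
        rw [Finsupp.erase_ne (Finset.ne_of_mem_erase hu)]
    rw [this, Finsupp.erase_same, pow_zero, one_mul]
    simp only [absMoment]; ring
  | add p q hp hq =>
    simp only [map_add]
    exact ⟨hp.1.add hq.1, by rw [integral_add hp.1 hq.1, hp.2, hq.2]⟩

variable [∀ u, IsProbabilityMeasure (ν u)]

lemma integrable_eval_abs (hν : ∀ u i, Integrable (fun t => |t| ^ i) (ν u))
    (P : MvPolynomial ι ℝ) :
    Integrable (fun y : ι → ℝ => eval (fun u => |y u|) P) (Measure.pi ν) := by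
  simp only [eval_eq']
  refine integrable_finsetSum _ fun e _ => Integrable.const_mul ?_ _
  exact Integrable.fintype_prod (f := fun u t => |t| ^ e u) fun u => hν u (e u)

lemma integral_eval_abs (hν : ∀ u i, Integrable (fun t => |t| ^ i) (ν u))
    (P : MvPolynomial ι ℝ) :
    ∫ y, eval (fun u => |y u|) P ∂Measure.pi ν = momentEval (absMoment ν) P := by
  simp only [eval_eq', momentEval_eq_sum]
  rw [integral_finsetSum]
  · refine Finset.sum_congr rfl fun e _ => ?_
    rw [integral_const_mul, integral_fintype_prod_eq_prod (fun u t => |t| ^ e u)]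
    rfl
  · intro e _
    exact (Integrable.fintype_prod (f := fun u t => |t| ^ e u) fun u => hν u (e u)).const_mul _

lemma PolyBounded.integrable (hν : ∀ u i, Integrable (fun t => |t| ^ i) (ν u))
    {F : (ι → ℝ) → ℝ} (hF : PolyBounded F) : Integrable F (Measure.pi ν) := by
  obtain ⟨hF, P, hP⟩ := hF
  exact (integrable_eval_abs hν P).mono' hF.aestronglyMeasurable (Filter.Eventually.of_forall hP)

variable [DecidableEq ι]

lemma measurable_update_prod {ι : Type*} [DecidableEq ι] (v : ι) :
    Measurable fun p : (ι → ℝ) × ℝ => Function.update p.1 v p.2 := by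
  refine measurable_pi_lambda _ fun u => ?_
  by_cases h : u = v
  · subst h; simpa using measurable_snd
  · simp only [Function.update_of_ne h]
    fun_prop

/-- Resampling one coordinate independently leaves the product law unchanged; Fubini then gives
iterated integrals without splitting the index type. -/
lemma measurePreserving_update_prod (v : ι) :
    MeasurePreserving (fun p : (ι → ℝ) × ℝ => Function.update p.1 v p.2)
      ((Measure.pi ν).prod (ν v)) (Measure.pi ν) := by
  refine ⟨measurable_update_prod v, ?_⟩
  symm
  refine Measure.pi_eq fun s hs => ?_
  rw [Measure.map_apply (measurable_update_prod v) (MeasurableSet.univ_pi hs)]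
  have : (fun p : (ι → ℝ) × ℝ => Function.update p.1 v p.2) ⁻¹' Set.univ.pi s
      = (Set.univ.pi (Function.update s v Set.univ)) ×ˢ s v := by
    ext ⟨y, t⟩
    simp only [Set.mem_preimage, Set.mem_pi, Set.mem_univ, true_implies, Set.mem_prod]
    constructor
    · intro h
      refine ⟨fun u => ?_, by simpa using h v⟩
      by_cases hu : u = v
      · subst hu; simp
      · simpa [Function.update_of_ne hu] using h u
    · rintro ⟨h1, h2⟩ u
      by_cases hu : u = v
      · subst hu; simpa using h2
      · simpa [Function.update_of_ne hu] using h1 u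
  rw [this, Measure.prod_prod, Measure.pi_pi, ← Finset.mul_prod_erase _ _ (Finset.mem_univ v),
    ← Finset.mul_prod_erase _ (fun u => ν u (s u)) (Finset.mem_univ v)]
  simp only [Function.update_self, measure_univ, one_mul]
  rw [mul_comm]
  congr 1
  refine Finset.prod_congr rfl fun u hu => ?_
  rw [Function.update_of_ne (Finset.ne_of_mem_erase hu)]

lemma integrable_update_prod {F : (ι → ℝ) → ℝ} (hF : Integrable F (Measure.pi ν)) (v : ι) :
    Integrable (fun p : (ι → ℝ) × ℝ => F (Function.update p.1 v p.2))
      ((Measure.pi ν).prod (ν v)) :=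
  (measurePreserving_update_prod v).integrable_comp_of_integrable hF

lemma integral_eq_integral_update {F : (ι → ℝ) → ℝ} (hF : Integrable F (Measure.pi ν)) (v : ι) :
    ∫ y, F y ∂Measure.pi ν = ∫ y, ∫ t, F (Function.update y v t) ∂ν v ∂Measure.pi ν := by
  have h1 := integral_prod _ (integrable_update_prod hF v)
  rw [← h1]
  have h2 := (measurePreserving_update_prod (ν := ν) v)
  conv_lhs => rw [← h2.map_eq]
  refine integral_map h2.measurable.aemeasurable ?_
  rw [h2.map_eq]
  exact hF.aestronglyMeasurable

lemma PolyBounded.integrable_slice {ν : ι → Measure ℝ} (hν : ∀ u i, Integrable (fun t => |t| ^ i) (ν u))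
    {F : (ι → ℝ) → ℝ} (hF : PolyBounded F) (v : ι) (y : ι → ℝ) :
    Integrable (fun t => F (Function.update y v t)) (ν v) := by
  obtain ⟨hF, P, hP⟩ := hF
  refine (slice_eval_abs hν v y P).1.mono' ?_ (Filter.Eventually.of_forall fun t => hP _)
  exact (hF.comp (measurable_update y)).aestronglyMeasurable

lemma eval_condMoment_update (v : ι) (y : ι → ℝ) (t : ℝ) (m : ι → ℕ → ℝ) (P : MvPolynomial ι ℝ) :
    eval (fun u => |Function.update y v t u|) (condMoment m v P)
      = eval (fun u => |y u|) (condMoment m v P) := by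
  simp only [condMoment_eq_sum, map_sum, eval_monomial]
  refine Finset.sum_congr rfl fun e _ => ?_
  rw [Finsupp.prod_fintype _ _ (fun _ => pow_zero _),
    Finsupp.prod_fintype _ _ (fun _ => pow_zero _)]
  congr 1
  refine Finset.prod_congr rfl fun u _ => ?_
  by_cases hu : u = v
  · subst hu; simp
  · rw [Function.update_of_ne hu]

lemma abs_integral_pow_le {μ : Measure ℝ} [IsProbabilityMeasure μ] {g : ℝ → ℝ} (l : ℕ)
    (hg : Integrable g μ) (hgl : Integrable (fun t => |g t| ^ l) μ) :
    |∫ t, g t ∂μ| ^ l ≤ ∫ t, |g t| ^ l ∂μ := by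
  calc |∫ t, g t ∂μ| ^ l ≤ (∫ t, |g t| ∂μ) ^ l := by
        gcongr; exact abs_integral_le_integral_abs
    _ ≤ ∫ t, |g t| ^ l ∂μ :=
        (convexOn_pow l).map_integral_le (by fun_prop) isClosed_Ici
          (Filter.Eventually.of_forall fun t => abs_nonneg (g t)) hg.abs hgl

/-- The contribution of one martingale difference `A` to the moment of order `r + 1` of `G`, where
`D` is the part of `G` depending on the coordinate `v`. -/
lemma integral_mul_pow_le (hν : ∀ u i, Integrable (fun t => |t| ^ i) (ν u)) (v : ι)
    {G A D : (ι → ℝ) → ℝ} {Pa Pd : MvPolynomial ι ℝ}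
    (hm : ∀ u i, 0 ≤ absMoment ν u i)
    (hG : PolyBounded G) (hA : Measurable A) (hD : Measurable D)
    (hPa : NonnegCoeff Pa) (hPd : NonnegCoeff Pd)
    (hAP : ∀ y, |A y| ≤ eval (fun u => |y u|) Pa) (hDP : ∀ y, |D y| ≤ eval (fun u => |y u|) Pd)
    (hA0 : ∀ y, ∫ t, A (Function.update y v t) ∂ν v = 0)
    (hD0 : ∀ y, ∫ t, D (Function.update y v t) ∂ν v = 0)
    (hGD : ∀ y t, G (Function.update y v t) - D (Function.update y v t) = G y - D y) (r : ℕ) :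
    ∫ y, A y * G y ^ r ∂Measure.pi ν
      ≤ ∑ j ∈ Finset.range r, (r.choose (j + 1) : ℝ) *
        ∫ y, eval (fun u => |y u|) (condMoment (absMoment ν) v (Pa * Pd ^ (j + 1))) *
          |G y| ^ (r - (j + 1)) ∂Measure.pi ν := by
  have hAb : PolyBounded A := .of_le hA Pa hAP
  have hDb : PolyBounded D := .of_le hD Pd hDP
  set E : (ι → ℝ) → ℝ := fun y => G y - D y with hE
  have hEb : PolyBounded E := hG.sub hDb
  have hmean : ∀ y, ∫ t, G (Function.update y v t) ∂ν v = E y := by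
    intro y
    have h1 : ∀ t, G (Function.update y v t) = D (Function.update y v t) + E y := by
      intro t
      have := hGD y t
      simp only [hE]; linarith
    simp only [h1]
    rw [integral_add (hDb.integrable_slice hν v y) (integrable_const _), hD0, zero_add]
    simp
  have hexp : ∀ y, A y * G y ^ r = A y * E y ^ r + ∑ j ∈ Finset.range r,
      (r.choose (j + 1) : ℝ) * (A y * D y ^ (j + 1) * E y ^ (r - (j + 1))) := by
    intro y
    have h1 : G y = D y + E y := by simp [hE]
    rw [h1, add_pow, Finset.sum_range_succ', mul_add, Finset.mul_sum, add_comm]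
    simp only [pow_zero, Nat.sub_zero, Nat.choose_zero_right, Nat.cast_one, one_mul, mul_one]
    congr 1
    exact Finset.sum_congr rfl fun j _ => by ring
  -- `E` does not depend on the coordinate `v`, while `A` has mean zero in it.
  have hzero : ∫ y, A y * E y ^ r ∂Measure.pi ν = 0 := by
    rw [integral_eq_integral_update ((hAb.mul (hEb.pow r)).integrable hν) v]
    have : ∀ y, ∫ t, A (Function.update y v t) * E (Function.update y v t) ^ r ∂ν v = 0 := by
      intro y
      have h1 : ∀ t, E (Function.update y v t) = E y := fun t => hGD y t
      simp only [h1]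
      rw [integral_mul_const, hA0, zero_mul]
    simp [this]
  have hterm : ∀ i, ∀ j, PolyBounded fun y => A y * D y ^ i * E y ^ j :=
    fun i j => (hAb.mul (hDb.pow i)).mul (hEb.pow j)
  simp only [hexp]
  rw [integral_add ((hAb.mul (hEb.pow r)).integrable hν)
    (integrable_finsetSum _ fun j _ => ((hterm _ _).integrable hν).const_mul _),
    hzero, zero_add, integral_finsetSum _ fun j _ => ((hterm _ _).integrable hν).const_mul _]
  refine Finset.sum_le_sum fun j _ => ?_
  rw [integral_const_mul]
  refine mul_le_mul_of_nonneg_left ?_ (Nat.cast_nonneg _)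
  set l := r - (j + 1) with hl
  set Q := condMoment (absMoment ν) v (Pa * Pd ^ (j + 1)) with hQ
  have hQn : NonnegCoeff Q := by
    rw [hQ, condMoment_eq_sum]
    exact NonnegCoeff.sum fun e _ => NonnegCoeff.monomial _
      (mul_nonneg (hPa.mul (hPd.pow _) e) (hm _ _))
  have hQG : PolyBounded fun y => eval (fun u => |y u|) Q * |G y| ^ l :=
    (PolyBounded.eval_abs hQn).mul (hG.abs.pow l)
  rw [integral_eq_integral_update ((hterm _ _).integrable hν) v,
    integral_eq_integral_update (hQG.integrable hν) v]
  refine integral_mono (integrable_update_prod ((hterm _ _).integrable hν) v).integral_prod_left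
    (integrable_update_prod (hQG.integrable hν) v).integral_prod_left fun y => ?_
  have h1 : ∀ t, E (Function.update y v t) = E y := fun t => hGD y t
  have h2 : ∀ t, eval (fun u => |Function.update y v t u|) Q = eval (fun u => |y u|) Q :=
    fun t => eval_condMoment_update v y t _ _
  simp only [h1, h2]
  rw [integral_mul_const, integral_const_mul]
  have hs := slice_eval_abs hν v y (Pa * Pd ^ (j + 1))
  have h3 : |∫ t, A (Function.update y v t) * D (Function.update y v t) ^ (j + 1) ∂ν v|
      ≤ eval (fun u => |y u|) Q := by
    rw [hQ, ← hs.2]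
    refine abs_integral_le_integral_abs.trans (integral_mono ?_ hs.1 fun t => ?_)
    · exact ((hAb.mul (hDb.pow (j + 1))).integrable_slice hν v y).abs
    · simp only [abs_mul, abs_pow, map_mul, map_pow]
      exact mul_le_mul (hAP _) (pow_le_pow_left₀ (abs_nonneg _) (hDP _) _) (by positivity)
        (hPa.eval_nonneg _)
  -- Jensen: `E` is the mean of `G` over the coordinate `v`.
  have h4 : |E y| ^ l ≤ ∫ t, |G (Function.update y v t)| ^ l ∂ν v := by
    rw [← hmean y]
    exact abs_integral_pow_le l (hG.integrable_slice hν v y)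
      ((hG.abs.pow l).integrable_slice hν v y)
  calc _ ≤ |(∫ t, A (Function.update y v t) * D (Function.update y v t) ^ (j + 1) ∂ν v) *
          E y ^ l| := le_abs_self _
    _ = |∫ t, A (Function.update y v t) * D (Function.update y v t) ^ (j + 1) ∂ν v| *
          |E y| ^ l := by rw [abs_mul, abs_pow]
    _ ≤ _ := mul_le_mul h3 h4 (by positivity) (hQn.eval_nonneg y)

/-- A substitute for Young's inequality with an integer exponent `p`, at least the conjugate one;
the `1` pays for rounding up. Either `N` is at most `max 1 g ^ (s + 1)` and is absorbed by the first
two terms, or it exceeds that and `N ^ p` dominates. -/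
lemma mul_pow_le_one_add {N g : ℝ} (hN : 0 ≤ N) (hg : 0 ≤ g) (a s p : ℕ)
    (hp : a + (s + 1) ≤ (s + 1) * p) : N * g ^ a ≤ 1 + g ^ (a + (s + 1)) + N ^ p := by
  have hgk : 0 ≤ g ^ (a + (s + 1)) := by positivity
  have hNp : 0 ≤ N ^ p := by positivity
  by_cases h : N ≤ (max 1 g) ^ (s + 1)
  · rcases le_total g 1 with hg1 | hg1
    · rw [max_eq_left hg1, one_pow] at h
      have : g ^ a ≤ 1 := pow_le_one₀ hg hg1
      nlinarith
    · rw [max_eq_right hg1] at h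
      have : N * g ^ a ≤ g ^ (s + 1) * g ^ a := by gcongr
      rw [← pow_add, add_comm] at this
      linarith
  · push Not at h
    have hN1 : 1 ≤ N := (one_le_pow₀ (le_max_left 1 g)).trans h.le
    have hgN : g ^ (s + 1) ≤ N := (pow_le_pow_left₀ hg (le_max_right 1 g) _).trans h.le
    have : N * g ^ a ≤ N ^ p := by
      refine le_of_pow_le_pow_left₀ (n := s + 1) (by omega) hNp ?_
      calc (N * g ^ a) ^ (s + 1) = N ^ (s + 1) * (g ^ (s + 1)) ^ a := by
            rw [mul_pow, ← pow_mul, ← pow_mul, mul_comm a]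
        _ ≤ N ^ (s + 1) * N ^ a := by gcongr
        _ = N ^ (a + (s + 1)) := by rw [← pow_add, add_comm]
        _ ≤ N ^ ((s + 1) * p) := pow_le_pow_right₀ hN1 hp
        _ = (N ^ p) ^ (s + 1) := by rw [← pow_mul, mul_comm]
    linarith

end Product

/-! ### Centred increments and their polynomial majorants -/

section Increment

open MvPolynomial

variable {ι : Type*} [Fintype ι] [DecidableEq ι]

/-- The centred part of `f` at the coordinate `v`, where the other coordinates are kept on `p` and
averaged off `p`. -/
noncomputable def increment (ν : ι → Measure ℝ) (f : MvPolynomial ι ℝ) (v : ι) (p : ι → Prop)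
    [DecidablePred p] (y : ι → ℝ) : ℝ :=
  ∑ h ∈ f.support, f.coeff h * ((y v ^ h v - ∫ t, t ^ h v ∂ν v) *
    ∏ u ∈ Finset.univ.erase v, if p u then y u ^ h u else ∫ t, t ^ h u ∂ν u)

/-- A polynomial in the absolute values of the coordinates that bounds `increment`. -/
noncomputable def incrementMajorant (ν : ι → Measure ℝ) (f : MvPolynomial ι ℝ) (v : ι)
    (p : ι → Prop) [DecidablePred p] : MvPolynomial ι ℝ :=
  ∑ h ∈ f.support with h v ≠ 0, C |f.coeff h| * ((X v ^ h v + C (absMoment ν v (h v))) *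
    ∏ u ∈ Finset.univ.erase v, if p u then X u ^ h u else C (absMoment ν u (h u)))

variable {ν : ι → Measure ℝ} {f : MvPolynomial ι ℝ} {v : ι} {p : ι → Prop} [DecidablePred p]

lemma measurable_increment : Measurable (increment ν f v p) := by
  unfold increment
  refine Finset.measurable_sum _ fun h _ => Measurable.const_mul (Measurable.mul ?_ ?_) _
  · fun_prop
  · refine Finset.measurable_prod _ fun u _ => ?_
    split_ifs <;> fun_prop

/-- The weight `2 * |f.coeff h|` comes from centring: both `|Y_v| ^ h v` and its mean are dominated
by the power itself. -/
lemma incrementMajorant_dominated {L : ℝ} (hm : IsMomentSeq (absMoment ν) L) :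
    Dominated (absMoment ν) (incrementMajorant ν f v p)
      (linkPoly f.support (fun h => 2 * |f.coeff h|) v) := by
  unfold incrementMajorant linkPoly
  refine Dominated.sum fun h _ => ?_
  have h1 : monomial h (2 * |f.coeff h|)
      = C |f.coeff h| * ((X v ^ h v + X v ^ h v) * ∏ u ∈ Finset.univ.erase v, X u ^ h u) := by
    rw [monomial_eq, Finsupp.prod_fintype _ _ (fun _ => pow_zero _),
      ← Finset.mul_prod_erase _ _ (Finset.mem_univ v), C_mul]
    have : (C 2 : MvPolynomial ι ℝ) = 2 := map_ofNat C 2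
    rw [this]; ring
  rw [h1]
  refine (Dominated.refl (NonnegCoeff.C (abs_nonneg _))).mul (Dominated.mul ?_ ?_)
  · exact (Dominated.refl ((NonnegCoeff.X v).pow _)).add (Dominated.const hm v _)
  · refine Dominated.prod fun u _ => ?_
    split_ifs
    · exact Dominated.refl ((NonnegCoeff.X u).pow _)
    · exact Dominated.const hm u _

lemma abs_integral_pow_le_absMoment {ι : Type*} {ν : ι → Measure ℝ} (u : ι) (i : ℕ) : |∫ t, t ^ i ∂ν u| ≤ absMoment ν u i := by
  refine abs_integral_le_integral_abs.trans (le_of_eq ?_)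
  simp only [abs_pow, absMoment]

lemma eval_sub_increment_update (y : ι → ℝ) (t : ℝ) :
    eval (Function.update y v t) f - increment ν f v (fun _ => True) (Function.update y v t)
      = eval y f - increment ν f v (fun _ => True) y := by
  have h1 : ∀ y : ι → ℝ, eval y f - increment ν f v (fun _ => True) y
      = ∑ h ∈ f.support, f.coeff h * ((∫ t, t ^ h v ∂ν v) *
        ∏ u ∈ Finset.univ.erase v, y u ^ h u) := by
    intro y
    rw [eval_eq', increment, ← Finset.sum_sub_distrib]
    refine Finset.sum_congr rfl fun h _ => ?_
    rw [← Finset.mul_prod_erase _ _ (Finset.mem_univ v)]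
    simp only [if_true]
    ring
  rw [h1, h1]
  refine Finset.sum_congr rfl fun h _ => ?_
  congr 2
  refine Finset.prod_congr rfl fun u hu => ?_
  rw [Function.update_of_ne (Finset.ne_of_mem_erase hu)]

variable [∀ u, IsProbabilityMeasure (ν u)]

lemma abs_increment_le (y : ι → ℝ) :
    |increment ν f v p y| ≤ eval (fun u => |y u|) (incrementMajorant ν f v p) := by
  unfold increment incrementMajorant
  rw [map_sum, Finset.sum_filter]
  refine (Finset.abs_sum_le_sum_abs _ _).trans (Finset.sum_le_sum fun h _ => ?_)
  split_ifs with hv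
  · rw [map_mul, map_mul, map_add, map_pow, eval_X, eval_C, eval_C, map_prod, abs_mul, abs_mul,
      Finset.abs_prod]
    refine mul_le_mul_of_nonneg_left (mul_le_mul ?_ ?_ (by positivity) ?_) (abs_nonneg _)
    · refine (abs_sub _ _).trans (add_le_add (abs_pow _ _).le (abs_integral_pow_le_absMoment v _))
    · refine Finset.prod_le_prod (fun u _ => abs_nonneg _) fun u _ => ?_
      split_ifs
      · simp
      · simpa using abs_integral_pow_le_absMoment (ν := ν) u (h u)
    · exact add_nonneg (by positivity) (integral_nonneg fun t => by positivity)
  · push Not at hv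
    simp [hv]

lemma integrable_pow_of_abs {μ : Measure ℝ} (i : ℕ) (h : Integrable (fun t => |t| ^ i) μ) :
    Integrable (fun t : ℝ => t ^ i) μ :=
  h.mono (by fun_prop) (Filter.Eventually.of_forall fun t => by simp)

lemma integral_increment_update (hν : ∀ u i, Integrable (fun t => |t| ^ i) (ν u)) (y : ι → ℝ) :
    ∫ t, increment ν f v p (Function.update y v t) ∂ν v = 0 := by
  have h1 : ∀ t, increment ν f v p (Function.update y v t)
      = ∑ h ∈ f.support, (t ^ h v - ∫ t, t ^ h v ∂ν v) * (f.coeff h *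
        ∏ u ∈ Finset.univ.erase v, if p u then y u ^ h u else ∫ t, t ^ h u ∂ν u) := by
    intro t
    unfold increment
    refine Finset.sum_congr rfl fun h _ => ?_
    have : ∏ u ∈ Finset.univ.erase v,
          (if p u then Function.update y v t u ^ h u else ∫ t, t ^ h u ∂ν u)
        = ∏ u ∈ Finset.univ.erase v, if p u then y u ^ h u else ∫ t, t ^ h u ∂ν u :=
      Finset.prod_congr rfl fun u hu => by
        rw [Function.update_of_ne (Finset.ne_of_mem_erase hu)]
    rw [this, Function.update_self]; ring
  have h2 : ∀ i, Integrable (fun t : ℝ => t ^ i - ∫ t, t ^ i ∂ν v) (ν v) := fun i =>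
    (integrable_pow_of_abs i (hν v i)).sub (integrable_const _)
  simp only [h1]
  rw [integral_finsetSum _ fun h _ => (h2 _).mul_const _]
  refine Finset.sum_eq_zero fun h _ => ?_
  rw [integral_mul_const, integral_sub (integrable_pow_of_abs _ (hν v _)) (integrable_const _)]
  simp

end Increment

/-! ### Martingale decomposition -/

section Telescope

open MvPolynomial

variable {n : ℕ} {ν : Fin n → Measure ℝ} [∀ u, IsProbabilityMeasure (ν u)]

lemma integrable_prod_pow (hν : ∀ u i, Integrable (fun t => |t| ^ i) (ν u)) (h : Fin n →₀ ℕ) :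
    Integrable (fun y : Fin n → ℝ => ∏ u, y u ^ h u) (Measure.pi ν) :=
  Integrable.fintype_prod (f := fun u t => t ^ h u) fun u => integrable_pow_of_abs _ (hν u _)

lemma integral_eval (hν : ∀ u i, Integrable (fun t => |t| ^ i) (ν u))
    (f : MvPolynomial (Fin n) ℝ) :
    ∫ y, eval y f ∂Measure.pi ν = ∑ h ∈ f.support, f.coeff h * ∏ u, ∫ t, t ^ h u ∂ν u := by
  simp only [eval_eq']
  rw [integral_finsetSum _ fun h _ => (integrable_prod_pow hν h).const_mul _]
  refine Finset.sum_congr rfl fun h _ => ?_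
  rw [integral_const_mul, integral_fintype_prod_eq_prod (fun u t => t ^ h u)]

/-- The martingale decomposition of a polynomial of independent variables. -/
lemma eval_sub_integral_eq_sum (hν : ∀ u i, Integrable (fun t => |t| ^ i) (ν u))
    (f : MvPolynomial (Fin n) ℝ) (y : Fin n → ℝ) :
    eval y f - ∫ y, eval y f ∂Measure.pi ν = ∑ v, increment ν f v (fun u => u < v) y := by
  -- `g i` averages `f` over the coordinates of index at least `i`; it runs from the mean of `f` at
  -- `0` to `f` at `n`.
  let g : ℕ → ℝ := fun i => ∑ h ∈ f.support, f.coeff h *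
    ∏ u : Fin n, if (u : ℕ) < i then y u ^ h u else ∫ t, t ^ h u ∂ν u
  have h1 : ∀ v : Fin n, increment ν f v (fun u => u < v) y = g (v + 1) - g v := by
    intro v
    simp only [g, increment]
    rw [← Finset.sum_sub_distrib]
    refine Finset.sum_congr rfl fun h _ => ?_
    rw [← Finset.mul_prod_erase (a := v) _
        (fun u : Fin n => if (u : ℕ) < (v : ℕ) + 1 then y u ^ h u else ∫ t, t ^ h u ∂ν u)
        (Finset.mem_univ v),
      ← Finset.mul_prod_erase (a := v) _
        (fun u : Fin n => if (u : ℕ) < (v : ℕ) then y u ^ h u else ∫ t, t ^ h u ∂ν u)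
        (Finset.mem_univ v)]
    have e1 : ∏ u ∈ Finset.univ.erase v,
          (if (u : ℕ) < (v : ℕ) + 1 then y u ^ h u else ∫ t, t ^ h u ∂ν u)
        = ∏ u ∈ Finset.univ.erase v, if u < v then y u ^ h u else ∫ t, t ^ h u ∂ν u := by
      refine Finset.prod_congr rfl fun u hu => ?_
      have hne : (u : ℕ) ≠ v := fun h => Finset.ne_of_mem_erase hu (Fin.ext h)
      have : ((u : ℕ) < (v : ℕ) + 1) ↔ u < v := by rw [Fin.lt_def]; omega
      simp only [this]
    have e2 : ∏ u ∈ Finset.univ.erase v,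
          (if (u : ℕ) < (v : ℕ) then y u ^ h u else ∫ t, t ^ h u ∂ν u)
        = ∏ u ∈ Finset.univ.erase v, if u < v then y u ^ h u else ∫ t, t ^ h u ∂ν u := by
      simp only [Fin.lt_def]
    rw [e1, e2]
    simp only [Nat.lt_succ_self, if_true, lt_irrefl, if_false]
    ring
  simp only [h1]
  rw [Fin.sum_univ_eq_sum_range (fun i => g (i + 1) - g i) n, Finset.sum_range_sub,
    integral_eval hν, eval_eq']
  simp [g]

end Telescope

/-! ### The central moment inequality -/

section MomentBound

open MvPolynomial

/-- With `k = r + 1`, the factorial in `r.choose (j + 1) ≤ k ^ (j + 1) / (j + 1)!` cancels the one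
from the cluster bound, and the powers of `k` are matched by the scale `2 * k`. The hypotheses on
`Λ` then bound `j` factors by `Λ / 4` each and the remaining pair by `(Λ / 4) ^ 2`. -/
lemma IsSmooth.scaled_moment_le {ι : Type*} [Fintype ι] [DecidableEq ι] {m : ι → ℕ → ℝ} {L : ℝ}
    {S : Finset (ι →₀ ℕ)} {w : (ι →₀ ℕ) → ℝ} {q Γ r : ℕ} {T T' M Λ : ℝ}
    (hs : IsSmooth m L S w q Γ (2 * (r + 1)) T) (hs' : IsSmooth m L S w q Γ 1 T')
    (hM : ∑ h ∈ S, w h * momentProd m h = M) (hΛ : 0 < Λ)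
    (h1 : 4 * (T * Real.exp q) ≤ Λ)
    (h2 : 16 * (q * ((T * Real.exp q) ^ 2 + (r + 1) * (T' * Real.exp q) * M)) ≤ Λ ^ 2)
    {j p : ℕ} (hp : p * (j + 2) ≤ 2 * (r + 1)) {Q : MvPolynomial ι ℝ}
    (hQ : Dominated m Q (clusterPoly m S w (j + 2))) :
    ((r.choose (j + 1) : ℝ) * (4 / Λ) ^ (j + 2)) ^ p * momentEval m (Q ^ p) ≤ 1 := by
  have hT := hs.T_nonneg
  have hT' := hs'.T_nonneg
  have hM0 : 0 ≤ M := hM ▸ Finset.sum_nonneg fun h _ =>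
    mul_nonneg (hs.weight_nonneg h) (hs.momentSeq.momentProd_nonneg h)
  set τ := T * Real.exp q with hτ
  set τ' := T' * Real.exp q with hτ'
  have hτ0 : 0 ≤ τ := by positivity
  have hτ0' : 0 ≤ τ' := by positivity
  set k : ℝ := (r : ℝ) + 1 with hk
  have hk0 : 0 < k := by positivity
  set B : ℝ := (τ / (2 * k)) ^ j * ((j + 1).factorial : ℝ) *
    (q * (2 * (τ / (2 * k)) * τ + τ' * M)) with hB
  have hB0 : 0 ≤ B := by positivity
  have hpow := momentEval_monomial_mul_pow_le (K := 2 * (r + 1)) (hs.clusterPoly_nonneg (j + 2))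
    (hs.clusterPoly_small (j + 2)) hB0 (by
      intro N a ha hN
      have := hs.momentEval_mul_clusterPoly_le hs' ha hN
      rw [hM] at this
      convert this using 2
      simp only [hB, hk, hτ, hτ']
      push_cast
      ring) p 0 0 IsSmall.zero (by omega)
  rw [hs.momentSeq.momentProd_zero, mul_one] at hpow
  have hone : monomial (0 : ι →₀ ℕ) (1 : ℝ) = 1 := rfl
  rw [hone, one_mul] at hpow
  have hCB : (r.choose (j + 1) : ℝ) * (4 / Λ) ^ (j + 2) * B ≤ 1 := by
    have hc : (r.choose (j + 1) : ℝ) ≤ k ^ (j + 1) / ((j + 1).factorial : ℝ) := by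
      refine (Nat.choose_le_pow_div (j + 1) r).trans ?_
      gcongr
      simp [hk]
    have hcB : (r.choose (j + 1) : ℝ) * B
        ≤ (τ / 2) ^ j * (q * (τ ^ 2 + k * τ' * M)) := by
      calc (r.choose (j + 1) : ℝ) * B ≤ k ^ (j + 1) / ((j + 1).factorial : ℝ) * B := by gcongr
        _ = (k * (τ / (2 * k))) ^ j * (q * (k * (2 * (τ / (2 * k)) * τ + τ' * M))) := by
            rw [hB, mul_pow, pow_succ]
            have : ((j + 1).factorial : ℝ) ≠ 0 := by positivity
            field_simp
        _ = _ := by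
            have e1 : k * (τ / (2 * k)) = τ / 2 := by field_simp
            rw [e1]
            have e2 : k * (2 * (τ / (2 * k)) * τ + τ' * M) = τ ^ 2 + k * τ' * M := by field_simp
            rw [e2]
    have hcB2 : (τ / 2) ^ j * (q * (τ ^ 2 + k * τ' * M)) ≤ (Λ / 4) ^ (j + 2) := by
      rw [pow_add]
      refine mul_le_mul (pow_le_pow_left₀ (by positivity) (by linarith) j) (by linarith)
        (by positivity) (by positivity)
    calc (r.choose (j + 1) : ℝ) * (4 / Λ) ^ (j + 2) * B
        = (4 / Λ) ^ (j + 2) * ((r.choose (j + 1) : ℝ) * B) := by ring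
      _ ≤ (4 / Λ) ^ (j + 2) * (Λ / 4) ^ (j + 2) := by
          gcongr
          exact hcB.trans hcB2
      _ = 1 := by
          rw [← mul_pow, div_mul_div_comm, mul_comm 4, div_self (by positivity), one_pow]
  calc _ ≤ ((r.choose (j + 1) : ℝ) * (4 / Λ) ^ (j + 2)) ^ p * B ^ p :=
        mul_le_mul_of_nonneg_left ((hQ.pow p).momentEval_le.trans hpow) (by positivity)
    _ = ((r.choose (j + 1) : ℝ) * (4 / Λ) ^ (j + 2) * B) ^ p := by rw [← mul_pow]
    _ ≤ 1 := pow_le_one₀ (by positivity) hCB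

variable {n : ℕ} {ν : Fin n → Measure ℝ} [∀ u, IsProbabilityMeasure (ν u)]

lemma polyBounded_eval (f : MvPolynomial (Fin n) ℝ) :
    PolyBounded fun y : Fin n → ℝ => eval y f := by
  simp only [eval_eq']
  exact PolyBounded.sum fun h _ => (PolyBounded.const _).mul
    (PolyBounded.prod fun u _ => (PolyBounded.coord u).pow _)

/-- The central moment inequality of order `r + 1`. -/
theorem integral_abs_sub_pow_le (hν : ∀ u i, Integrable (fun t => |t| ^ i) (ν u))
    (f : MvPolynomial (Fin n) ℝ) {L : ℝ} {q Γ r : ℕ} {T T' M Λ : ℝ}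
    (hs : IsSmooth (absMoment ν) L f.support (fun h => 2 * |f.coeff h|) q Γ (2 * (r + 1)) T)
    (hs' : IsSmooth (absMoment ν) L f.support (fun h => 2 * |f.coeff h|) q Γ 1 T')
    (hM : ∑ h ∈ f.support, 2 * |f.coeff h| * momentProd (absMoment ν) h = M) (hΛ : 0 < Λ)
    (h1 : 4 * (T * Real.exp q) ≤ Λ)
    (h2 : 16 * (q * ((T * Real.exp q) ^ 2 + (r + 1) * (T' * Real.exp q) * M)) ≤ Λ ^ 2)
    (hr : Even (r + 1)) :
    ∫ y, |eval y f - ∫ y, eval y f ∂Measure.pi ν| ^ (r + 1) ∂Measure.pi ν ≤ Λ ^ (r + 1) := by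
  set μ := Measure.pi ν with hμ
  set G : (Fin n → ℝ) → ℝ := fun y => eval y f - ∫ y, eval y f ∂μ with hGdef
  have hm := hs.momentSeq
  have hG : PolyBounded G := (polyBounded_eval f).sub (PolyBounded.const _)
  let A : Fin n → (Fin n → ℝ) → ℝ := fun v => increment ν f v (fun u => u < v)
  let Pa : Fin n → MvPolynomial (Fin n) ℝ := fun v => incrementMajorant ν f v (fun u => u < v)
  let Pd : Fin n → MvPolynomial (Fin n) ℝ := fun v => incrementMajorant ν f v (fun _ => True)
  have hPa : ∀ v, Dominated (absMoment ν) (Pa v) _ := fun v => incrementMajorant_dominated hm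
  have hPd : ∀ v, Dominated (absMoment ν) (Pd v) _ := fun v => incrementMajorant_dominated hm
  have hA : ∀ v, PolyBounded (A v) := fun v =>
    .of_le measurable_increment _ (abs_increment_le (ν := ν))
  have hsum : ∀ y, G y = ∑ v, A v y := fun y => eval_sub_integral_eq_sum hν f y
  let Q : ℕ → MvPolynomial (Fin n) ℝ := fun j =>
    ∑ v, condMoment (absMoment ν) v (Pa v * Pd v ^ (j + 1))
  have hQ : ∀ j, Dominated (absMoment ν) (Q j) (clusterPoly (absMoment ν) f.support
      (fun h => 2 * |f.coeff h|) (j + 2)) := by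
    intro j
    refine Dominated.sum fun v _ => Dominated.condMoment hm v ?_
    rw [pow_succ' _ (j + 1)]
    exact (hPa v).mul ((hPd v).pow _)
  have hQG : ∀ j l, PolyBounded fun y => eval (fun u => |y u|) (Q j) * |G y| ^ l := fun j l =>
    (PolyBounded.eval_abs (hQ j).left).mul (hG.abs.pow l)
  have hstep : ∫ y, |G y| ^ (r + 1) ∂μ ≤ ∑ j ∈ Finset.range r, (r.choose (j + 1) : ℝ) *
      ∫ y, eval (fun u => |y u|) (Q j) * |G y| ^ (r - (j + 1)) ∂μ := by
    -- Evenness of `r + 1` removes the absolute value, and one factor `G` is expanded into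
    -- martingale differences.
    have e1 : ∀ y, |G y| ^ (r + 1) = ∑ v, A v y * G y ^ r := by
      intro y
      rw [hr.pow_abs, pow_succ', ← Finset.sum_mul, ← hsum]
    simp only [e1]
    rw [integral_finsetSum _ fun v _ => ((hA v).mul (hG.pow r)).integrable hν]
    refine (Finset.sum_le_sum fun v _ => integral_mul_pow_le hν v (fun u i => hm.nonneg u i) hG
      measurable_increment measurable_increment (hPa v).left (hPd v).left abs_increment_le
      abs_increment_le (integral_increment_update hν) (integral_increment_update hν) ?_ r).trans ?_
    · intro y t
      have := eval_sub_increment_update (ν := ν) (f := f) (v := v) y t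
      simp only [hGdef]; linarith
    · rw [Finset.sum_comm]
      refine Finset.sum_le_sum fun j _ => ?_
      rw [← Finset.mul_sum, ← integral_finsetSum]
      · simp only [Q, map_sum, Finset.sum_mul]
        exact le_rfl
      · intro v _
        exact ((PolyBounded.eval_abs (((hPa v).mul ((hPd v).pow _)).condMoment hm v).left).mul
          (hG.abs.pow _)).integrable hν
  set x : ℝ := ∫ y, (|G y| / Λ) ^ (r + 1) ∂μ with hx
  have hxG : ∫ y, |G y| ^ (r + 1) ∂μ = Λ ^ (r + 1) * x := by
    rw [hx, ← integral_const_mul]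
    refine integral_congr_ae (Filter.Eventually.of_forall fun y => ?_)
    simp only [← mul_pow]
    rw [mul_div_cancel₀ _ hΛ.ne']
  have hx0 : 0 ≤ x := integral_nonneg fun y => by positivity
  have hterm : ∀ j ∈ Finset.range r, (r.choose (j + 1) : ℝ) *
      ∫ y, eval (fun u => |y u|) (Q j) * |G y| ^ (r - (j + 1)) ∂μ
        ≤ Λ ^ (r + 1) * (1 / 4) ^ (j + 2) * (2 + x) := by
    intro j hj
    rw [Finset.mem_range] at hj
    set l := r - (j + 1) with hl
    have hlr : r + 1 = l + (j + 1 + 1) := by omega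
    -- The Young-type inequality needs `r + 1 ≤ (j + 2) * p`. Rounding up may overshoot, but `j + 2
    -- ≤ r + 1` keeps `p * (j + 2) ≤ 2 * (r + 1)`, which explains the scale.
    set p := (r + 1) / (j + 2) + 1 with hp
    have hp1 : l + (j + 1 + 1) ≤ (j + 1 + 1) * p := by
      rw [← hlr, hp, mul_add, mul_one]
      have := Nat.div_add_mod (r + 1) (j + 2)
      have := Nat.mod_lt (r + 1) (show 0 < j + 2 by omega)
      have e : (j + 1 + 1) * ((r + 1) / (j + 2)) = (j + 2) * ((r + 1) / (j + 2)) := rfl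
      omega
    have hp2 : p * (j + 2) ≤ 2 * (r + 1) := by
      have := Nat.div_mul_le_self (r + 1) (j + 2)
      rw [hp, add_mul, one_mul]; omega
    set c : ℝ := (r.choose (j + 1) : ℝ) * (4 / Λ) ^ (j + 2) with hc
    have hc0 : 0 ≤ c := by positivity
    have hmom := hs.scaled_moment_le hs' hM hΛ h1 h2 hp2 (hQ j)
    rw [← hc, ← integral_eval_abs hν, ← integral_const_mul] at hmom
    have hpt : ∀ y, (r.choose (j + 1) : ℝ) * (eval (fun u => |y u|) (Q j) * |G y| ^ l)
        ≤ Λ ^ (r + 1) * (1 / 4) ^ (j + 2) *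
          (1 + (|G y| / Λ) ^ (r + 1) + c ^ p * eval (fun u => |y u|) (Q j ^ p)) := by
      intro y
      have hq0 := (hQ j).left.eval_nonneg y
      have h3 := mul_pow_le_one_add (mul_nonneg hc0 hq0)
        (by positivity : 0 ≤ |G y| / Λ) l (j + 1) p hp1
      rw [← hlr, mul_pow c, ← map_pow] at h3
      refine le_trans (le_of_eq ?_) (mul_le_mul_of_nonneg_left h3 (by positivity))
      rw [hc, show r + 1 = l + (j + 2) from hlr, div_pow, div_pow, div_pow, pow_add, one_pow]
      field_simp
    have i1 : Integrable (fun y => (|G y| / Λ) ^ (r + 1)) μ := by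
      simp only [div_pow]
      exact ((hG.abs.pow (r + 1)).integrable hν).div_const _
    have i2 : Integrable (fun y => c ^ p * eval (fun u => |y u|) (Q j ^ p)) μ :=
      (integrable_eval_abs hν _).const_mul _
    have i3 : Integrable (fun y => 1 + (|G y| / Λ) ^ (r + 1)) μ := (integrable_const _).add i1
    rw [← integral_const_mul]
    calc _ ≤ ∫ y, Λ ^ (r + 1) * (1 / 4) ^ (j + 2) *
          (1 + (|G y| / Λ) ^ (r + 1) + c ^ p * eval (fun u => |y u|) (Q j ^ p)) ∂μ :=
          integral_mono (((hQG j l).integrable hν).const_mul _)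
            ((i3.add i2).const_mul _) hpt
      _ = Λ ^ (r + 1) * (1 / 4) ^ (j + 2) *
          (1 + x + ∫ y, c ^ p * eval (fun u => |y u|) (Q j ^ p) ∂μ) := by
          rw [integral_const_mul, integral_add i3 i2,
            integral_add (integrable_const _) i1]
          simp [hx]
      _ ≤ _ := by
          refine mul_le_mul_of_nonneg_left ?_ (by positivity)
          linarith
  have hgeo : ∑ j ∈ Finset.range r, (1 / 4 : ℝ) ^ (j + 2) ≤ 1 / 12 := by
    have e : ∀ j, (1 / 4 : ℝ) ^ (j + 2) = (1 / 16) * (1 / 4) ^ j := fun j => by ring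
    simp only [e]
    rw [← Finset.mul_sum, geom_sum_eq (by norm_num)]
    have : (0 : ℝ) ≤ (1 / 4) ^ r := by positivity
    rw [← mul_div_assoc, div_le_iff_of_neg (by norm_num)]
    linarith
  have hΛk : 0 < Λ ^ (r + 1) := by positivity
  have hfin : Λ ^ (r + 1) * x ≤ Λ ^ (r + 1) * ((1 / 12) * (2 + x)) := by
    rw [← hxG]
    refine hstep.trans ((Finset.sum_le_sum hterm).trans ?_)
    rw [← Finset.sum_mul, ← Finset.mul_sum, mul_assoc]
    gcongr
  -- The self-bounding inequality `x ≤ (2 + x) / 12` forces `x ≤ 2 / 11`.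
  have hx1 : x ≤ 1 := by
    have := le_of_mul_le_mul_left hfin hΛk
    linarith
  rw [hxG]
  calc Λ ^ (r + 1) * x ≤ Λ ^ (r + 1) * 1 := by gcongr
    _ = _ := mul_one _

end MomentBound

/-! ### From moment bounded variables to moment sequences -/

section Laws

lemma MomentBounded.integrable_and_step {Ω : Type*} [MeasurableSpace Ω] {P : Measure Ω}
    [IsProbabilityMeasure P] {Z : Ω → ℝ} {L : ℝ} (hL : 0 < L) (hZ : Measurable Z)
    (h : MomentBounded P Z L) :
    (∀ i : ℕ, Integrable (fun ω => |Z ω| ^ i) P) ∧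
      ∀ i : ℕ, ∫ ω, |Z ω| ^ (i + 1) ∂P ≤ ((i : ℝ) + 1) * L * ∫ ω, |Z ω| ^ i ∂P := by
  have hfin : ∀ i : ℕ, ∫⁻ ω, ENNReal.ofReal (|Z ω| ^ i) ∂P < ⊤ := by
    intro i
    induction i with
    | zero => simp
    | succ i ih =>
      exact (h (i + 1) (by omega)).trans_lt (ENNReal.mul_lt_top ENNReal.ofReal_lt_top
        (by rw [Nat.add_sub_cancel]; exact ih))
  have hint : ∀ i : ℕ, Integrable (fun ω => |Z ω| ^ i) P := by
    intro i
    refine ⟨by fun_prop, ?_⟩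
    rw [hasFiniteIntegral_iff_ofReal (Filter.Eventually.of_forall fun ω => by positivity)]
    exact hfin i
  refine ⟨hint, fun i => ?_⟩
  have h1 := h (i + 1) (by omega)
  have hpos : ∀ j : ℕ, 0 ≤ᵐ[P] fun ω => |Z ω| ^ j :=
    fun j => Filter.Eventually.of_forall fun ω => by positivity
  rw [Nat.add_sub_cancel, ← ofReal_integral_eq_lintegral_ofReal (hint _) (hpos _),
    ← ofReal_integral_eq_lintegral_ofReal (hint _) (hpos _),
    ← ENNReal.ofReal_mul (by positivity)] at h1
  have h0 : 0 ≤ ∫ ω, |Z ω| ^ i ∂P := integral_nonneg fun ω => by positivity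
  have h2 := (ENNReal.ofReal_le_ofReal_iff (by positivity)).1 h1
  push_cast at h2
  exact h2

/-- Chebyshev's association inequality for absolute moments. -/
lemma integral_abs_pow_mul_le {μ : Measure ℝ} [IsProbabilityMeasure μ]
    (hμ : ∀ i : ℕ, Integrable (fun t => |t| ^ i) μ) (i j : ℕ) :
    (∫ t, |t| ^ i ∂μ) * ∫ t, |t| ^ j ∂μ ≤ ∫ t, |t| ^ (i + j) ∂μ := by
  rcases Nat.eq_zero_or_pos i with rfl | hi
  · simp
  -- Since `|t| ^ i - a ^ i` and `|t| ^ j - a ^ j` have the same sign, their product is nonnegative.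
  -- For this `a` the first has mean zero, so integration leaves exactly the claim.
  set a : ℝ := (∫ t, |t| ^ i ∂μ) ^ ((1 : ℝ) / i) with ha
  have hm0 : 0 ≤ ∫ t, |t| ^ i ∂μ := integral_nonneg fun t => by positivity
  have ha0 : 0 ≤ a := Real.rpow_nonneg hm0 _
  have hai : a ^ i = ∫ t, |t| ^ i ∂μ := by
    rw [ha, ← Real.rpow_natCast, ← Real.rpow_mul hm0, one_div,
      inv_mul_cancel₀ (by positivity), Real.rpow_one]
  have hpt : ∀ t : ℝ, 0 ≤ |t| ^ (i + j) - a ^ i * |t| ^ j - a ^ j * |t| ^ i + a ^ (i + j) := by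
    intro t
    have : |t| ^ (i + j) - a ^ i * |t| ^ j - a ^ j * |t| ^ i + a ^ (i + j)
        = (|t| ^ i - a ^ i) * (|t| ^ j - a ^ j) := by ring
    rw [this]
    rcases le_total |t| a with hta | hta
    · exact mul_nonneg_of_nonpos_of_nonpos
        (sub_nonpos.2 (pow_le_pow_left₀ (abs_nonneg t) hta i))
        (sub_nonpos.2 (pow_le_pow_left₀ (abs_nonneg t) hta j))
    · exact mul_nonneg (sub_nonneg.2 (pow_le_pow_left₀ ha0 hta i))
        (sub_nonneg.2 (pow_le_pow_left₀ ha0 hta j))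
  have hint : 0 ≤ ∫ t, (|t| ^ (i + j) - a ^ i * |t| ^ j - a ^ j * |t| ^ i + a ^ (i + j)) ∂μ :=
    integral_nonneg hpt
  have i1 := (hμ (i + j)).sub ((hμ j).const_mul (a ^ i))
  have i2 := i1.sub ((hμ i).const_mul (a ^ j))
  have e : ∫ t, |t| ^ (i + j) - a ^ i * |t| ^ j - a ^ j * |t| ^ i + a ^ (i + j) ∂μ
      = ∫ t, |t| ^ (i + j) ∂μ - a ^ i * ∫ t, |t| ^ j ∂μ - a ^ j * ∫ t, |t| ^ i ∂μ
        + a ^ (i + j) := by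
    calc _ = ∫ t, (|t| ^ (i + j) - a ^ i * |t| ^ j - a ^ j * |t| ^ i) ∂μ
          + ∫ _, a ^ (i + j) ∂μ := integral_add i2 (integrable_const _)
      _ = (∫ t, (|t| ^ (i + j) - a ^ i * |t| ^ j) ∂μ - ∫ t, a ^ j * |t| ^ i ∂μ)
          + ∫ _, a ^ (i + j) ∂μ := by
          congr 1
          exact integral_sub i1 ((hμ i).const_mul _)
      _ = _ := by
          rw [integral_sub (hμ _) ((hμ j).const_mul _), integral_const_mul, integral_const_mul]
          simp
  rw [e, pow_add, hai] at hint
  nlinarith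

variable {n : ℕ} {Ω : Type*} [MeasurableSpace Ω] {P : Measure Ω}
  {Y : Fin n → Ω → ℝ} {L : ℝ}

lemma absMoment_map (hY : ∀ v, Measurable (Y v)) (v : Fin n) (i : ℕ) :
    absMoment (fun v => P.map (Y v)) v i = ∫ ω, |Y v ω| ^ i ∂P :=
  integral_map (hY v).aemeasurable (by fun_prop)

variable [IsProbabilityMeasure P]

lemma integrable_abs_pow_map (hL : 0 < L) (hY : ∀ v, Measurable (Y v))
    (hmb : ∀ v, MomentBounded P (Y v) L) (v : Fin n) (i : ℕ) :
    Integrable (fun t => |t| ^ i) (P.map (Y v)) := by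
  rw [integrable_map_measure (by fun_prop) (hY v).aemeasurable]
  exact ((hmb v).integrable_and_step hL (hY v)).1 i

lemma isMomentSeq_map (hL : 0 < L) (hY : ∀ v, Measurable (Y v))
    (hmb : ∀ v, MomentBounded P (Y v) L) :
    IsMomentSeq (absMoment fun v => P.map (Y v)) L where
  zero v := by
    have := Measure.isProbabilityMeasure_map (μ := P) (hY v).aemeasurable
    simp [absMoment]
  nonneg v i := integral_nonneg fun t => by positivity
  step v i := by
    rw [absMoment_map hY, absMoment_map hY]
    exact ((hmb v).integrable_and_step hL (hY v)).2 i
  mul_le v i j := by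
    have := Measure.isProbabilityMeasure_map (μ := P) (hY v).aemeasurable
    exact integral_abs_pow_mul_le (integrable_abs_pow_map hL hY hmb v) i j

end Laws

/-! ### Smoothness from the parameters `mu` -/

section Smoothness

open MvPolynomial

variable {n : ℕ} {Ω : Type*} [MeasurableSpace Ω] {P : Measure Ω}
  {Y : Fin n → Ω → ℝ} {L : ℝ} {f : MvPolynomial (Fin n) ℝ}

lemma muAt_nonneg (h₀ : Fin n →₀ ℕ) : 0 ≤ muAt P Y f h₀ :=
  Finset.sum_nonneg fun _ _ => mul_nonneg (abs_nonneg _)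
    (Finset.prod_nonneg fun _ _ => integral_nonneg fun _ => abs_nonneg _)

lemma muAt_le_mu (h₀ : Fin n →₀ ℕ) : muAt P Y f h₀ ≤ mu P Y f h₀.degree := by
  classical
  refine le_ciSup (f := fun h : {h : Fin n →₀ ℕ // h.degree = h₀.degree} => muAt P Y f h.1)
    ?_ ⟨h₀, rfl⟩
  -- A bound independent of `h₀`, needed because a real supremum is only meaningful for a bounded
  -- family: replacing each moment by its maximum with `1` covers every subproduct.
  refine ⟨∑ h ∈ f.support, |f.coeff h| * ∏ v, max 1 (∫ ω, |Y v ω ^ h v| ∂P), ?_⟩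
  rintro _ ⟨h₁, rfl⟩
  have hprod : ∀ (h : Fin n →₀ ℕ) (s : Finset (Fin n)),
      ∏ v ∈ s, ∫ ω, |Y v ω ^ h v| ∂P ≤ ∏ v, max 1 (∫ ω, |Y v ω ^ h v| ∂P) := by
    intro h s
    have e : ∏ v ∈ s, ∫ ω, |Y v ω ^ h v| ∂P
        = ∏ v, if v ∈ s then ∫ ω, |Y v ω ^ h v| ∂P else 1 := by
      rw [Finset.prod_ite_mem, Finset.univ_inter]
    rw [e]
    refine Finset.prod_le_prod (fun v _ => ?_) fun v _ => ?_
    · split_ifs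
      · exact integral_nonneg fun ω => abs_nonneg _
      · exact zero_le_one
    · split_ifs
      · exact le_max_right _ _
      · exact le_max_left _ _
  refine (Finset.sum_le_sum fun h _ =>
    mul_le_mul_of_nonneg_left (hprod h _) (abs_nonneg _)).trans ?_
  refine Finset.sum_le_sum_of_subset_of_nonneg (Finset.filter_subset _ _) fun h _ _ => ?_
  exact mul_nonneg (abs_nonneg _) (Finset.prod_nonneg fun v _ => le_max_of_le_left zero_le_one)

lemma mu_nonneg (r : ℕ) : 0 ≤ mu P Y f r :=
  Real.iSup_nonneg fun h => muAt_nonneg h.1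

lemma degree_le_totalDegree_of_mem {h : Fin n →₀ ℕ} (hh : h ∈ f.support) :
    h.degree ≤ f.totalDegree := by
  rw [Finsupp.degree_apply]
  exact le_totalDegree hh

variable [IsProbabilityMeasure P]

lemma extMass_eq_muAt (hL : 0 < L) (hY : ∀ v, Measurable (Y v))
    (hmb : ∀ v, MomentBounded P (Y v) L) (h₀ : Fin n →₀ ℕ) :
    extMass (absMoment fun v => P.map (Y v)) f.support (fun h => 2 * |f.coeff h|) h₀
      = 2 * muAt P Y f h₀ := by
  classical
  have hm := isMomentSeq_map hL hY hmb
  unfold extMass muAt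
  rw [Finset.mul_sum]
  refine Finset.sum_congr (by unfold Extends; congr!) fun h _ => ?_
  rw [mul_assoc]
  congr 2
  symm
  have h1 : ∏ v ∈ h.support \ h₀.support, ∫ ω, |Y v ω ^ h v| ∂P
      = ∏ v ∈ h.support \ h₀.support, absMoment (fun v => P.map (Y v)) v (h v) :=
    Finset.prod_congr rfl fun v _ => by rw [absMoment_map hY]; simp only [abs_pow]
  rw [h1]
  refine Finset.prod_subset (fun v hv => ?_) fun v hv hv' => ?_
  · exact Finset.mem_compl.2 (Finset.mem_sdiff.1 hv).2
  · have : h v = 0 := by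
      by_contra hne
      exact hv' (Finset.mem_sdiff.2 ⟨Finsupp.mem_support_iff.2 hne, Finset.mem_compl.1 hv⟩)
    rw [this, hm.zero]

/-- The summand with `s = h₀.degree` alone covers `h₀`; if that degree exceeds `q`, no monomial of
`f` extends `h₀`. -/
lemma isSmooth_of_mu (hL : 0 < L) (hY : ∀ v, Measurable (Y v))
    (hmb : ∀ v, MomentBounded P (Y v) L) {q Γ K : ℕ} (hq : f.totalDegree ≤ q)
    (hΓ : ∀ v, f.degreeOf v ≤ Γ) (hΓ1 : 1 ≤ Γ) (hK : 1 ≤ K) :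
    IsSmooth (absMoment fun v => P.map (Y v)) L f.support (fun h => 2 * |f.coeff h|) q Γ K
      (∑ s ∈ Finset.Icc 1 q, 2 * ((4 * K * L * Γ) ^ s * mu P Y f s)) where
  momentSeq := isMomentSeq_map hL hY hmb
  L_pos := hL
  one_le_scale := hK
  one_le_power := hΓ1
  weight_nonneg h := by positivity
  power_le h hh v := (monomial_le_degreeOf v hh).trans (hΓ v)
  degree_le h hh := (degree_le_totalDegree_of_mem hh).trans hq
  T_nonneg := Finset.sum_nonneg fun s _ => by
    have := mu_nonneg (P := P) (Y := Y) (f := f) s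
    positivity
  extMass_le h₀ hh₀ := by
    have hK' : (1 : ℝ) ≤ K := by exact_mod_cast hK
    have hΓ' : (1 : ℝ) ≤ Γ := by exact_mod_cast hΓ1
    have hnn : ∀ s, 0 ≤ 2 * ((4 * K * L * Γ) ^ s * mu P Y f s) := fun s => by
      have := mu_nonneg (P := P) (Y := Y) (f := f) s
      positivity
    rw [extMass_eq_muAt hL hY hmb]
    by_cases hd : h₀.degree ≤ q
    · have hd1 : 1 ≤ h₀.degree := by
        rw [Nat.one_le_iff_ne_zero]
        exact fun h => hh₀ ((Finsupp.degree_eq_zero_iff h₀).1 h)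
      have h1 := Finset.single_le_sum (s := Finset.Icc 1 q)
        (f := fun s => 2 * ((4 * K * L * Γ) ^ s * mu P Y f s)) (fun s _ => hnn s)
        (Finset.mem_Icc.2 ⟨hd1, hd⟩)
      have h2 := muAt_le_mu (P := P) (Y := Y) (f := f) h₀
      calc 2 * muAt P Y f h₀ ≤ 2 * mu P Y f h₀.degree := by gcongr
        _ = 2 * ((4 * K * L * Γ) ^ h₀.degree * mu P Y f h₀.degree) *
              (1 / (4 * K * L * Γ)) ^ h₀.degree := by
            rw [one_div, inv_pow]
            field_simp
        _ ≤ _ := by gcongr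
    · have : muAt P Y f h₀ = 0 := by
        classical
        unfold muAt
        rw [Finset.filter_false_of_mem, Finset.sum_empty]
        intro h hh hext
        apply hd
        have h1 : h₀.degree ≤ h.degree := by
          rw [Finsupp.degree_eq_sum, Finsupp.degree_eq_sum]
          refine Finset.sum_le_sum fun v _ => ?_
          by_cases hv : v ∈ h₀.support
          · exact (hext v hv).ge
          · rw [Finsupp.notMem_support_iff.1 hv]; exact Nat.zero_le _
        exact h1.trans ((degree_le_totalDegree_of_mem hh).trans hq)
      rw [this, mul_zero]
      exact mul_nonneg (Finset.sum_nonneg fun s _ => hnn s) (by positivity)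

lemma sum_mass_le (hL : 0 < L) (hY : ∀ v, Measurable (Y v))
    (hmb : ∀ v, MomentBounded P (Y v) L) :
    ∑ h ∈ f.support, 2 * |f.coeff h| * momentProd (absMoment fun v => P.map (Y v)) h
      ≤ 2 * mu P Y f 0 := by
  have h1 := muAt_le_mu (P := P) (Y := Y) (f := f) 0
  have h2 := extMass_eq_muAt (f := f) hL hY hmb 0
  rw [map_zero] at h1
  have h3 : extMass (absMoment fun v => P.map (Y v)) f.support (fun h => 2 * |f.coeff h|) 0
      = ∑ h ∈ f.support, 2 * |f.coeff h| * momentProd (absMoment fun v => P.map (Y v)) h := by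
    unfold extMass momentProd
    simp
  linarith

end Smoothness

/-! ### Constants, Markov's inequality and the tail bound -/

section Tail

open MvPolynomial

variable {n : ℕ} {Ω : Type*} [MeasurableSpace Ω] {P : Measure Ω}
  {Y : Fin n → Ω → ℝ} {L : ℝ} {f : MvPolynomial (Fin n) ℝ}

/-- A nonconstant monomial `h` of `f` extends itself with an empty product, so `muAt` at `h` is at
least `|f.coeff h| > 0`, whatever the laws are. -/
lemma exists_mu_pos (hf : ∀ c, f ≠ C c) : ∃ h ∈ f.support, h ≠ 0 ∧ 0 < mu P Y f h.degree := by
  have h1 : ∃ h ∈ f.support, h ≠ 0 := by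
    by_contra hcon
    push Not at hcon
    refine hf (f.coeff 0) ((totalDegree_eq_zero_iff_eq_C (p := f)).1 ?_)
    rw [totalDegree_eq_zero_iff]
    intro h hh v
    rw [hcon h hh]; rfl
  obtain ⟨h, hh, h0⟩ := h1
  refine ⟨h, hh, h0, lt_of_lt_of_le ?_ (muAt_le_mu h)⟩
  classical
  have h2 : |f.coeff h| * ∏ v ∈ h.support \ h.support, ∫ ω, |Y v ω ^ h v| ∂P ≤ muAt P Y f h :=
    Finset.single_le_sum (s := f.support.filter fun h' => Extends h' h)
      (f := fun h' => |f.coeff h'| * ∏ v ∈ h'.support \ h.support, ∫ ω, |Y v ω ^ h' v| ∂P)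
      (fun h' _ => mul_nonneg (abs_nonneg _) (Finset.prod_nonneg fun v _ =>
        integral_nonneg fun ω => abs_nonneg _)) (Finset.mem_filter.2 ⟨hh, fun v _ => rfl⟩)
  refine lt_of_lt_of_le ?_ h2
  rw [Finset.sdiff_self, Finset.prod_empty, mul_one]
  exact abs_pos.2 (mem_support_iff.1 hh)

variable [IsProbabilityMeasure P]

/-- Polynomially bounded functions of independent moment bounded variables are integrable, and
their expectations are integrals against the product of the laws. -/
lemma PolyBounded.integrable_comp_and_integral_comp (hL : 0 < L) (hY : ∀ v, Measurable (Y v))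
    (hind : iIndepFun Y P) (hmb : ∀ v, MomentBounded P (Y v) L) {F : (Fin n → ℝ) → ℝ}
    (hF : PolyBounded F) :
    Integrable (fun ω => F fun v => Y v ω) P ∧
      ∫ ω, F (fun v => Y v ω) ∂P = ∫ y, F y ∂Measure.pi fun v => P.map (Y v) := by
  have hprob : ∀ v, IsProbabilityMeasure (P.map (Y v)) := fun v =>
    Measure.isProbabilityMeasure_map (hY v).aemeasurable
  have hYm : Measurable fun ω v => Y v ω := measurable_pi_lambda _ hY
  have hmap : P.map (fun ω v => Y v ω) = Measure.pi fun v => P.map (Y v) :=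
    (iIndepFun_iff_map_fun_eq_pi_map fun v => (hY v).aemeasurable).1 hind
  have hFi := hF.integrable (integrable_abs_pow_map hL hY hmb)
  rw [← hmap] at hFi ⊢
  exact ⟨hFi.comp_measurable hYm,
    (integral_map hYm.aemeasurable hFi.aestronglyMeasurable).symm⟩

/-- The central moment inequality of even order `k = r + 1`, in terms of the smoothness
parameters. -/
theorem integral_central_moment_le (hL : 0 < L) (hY : ∀ v, Measurable (Y v))
    (hind : iIndepFun Y P) (hmb : ∀ v, MomentBounded P (Y v) L) {q Γ r : ℕ}
    (hq : f.totalDegree ≤ q) (hΓ : ∀ v, f.degreeOf v ≤ Γ) (hq1 : 1 ≤ q) (hΓ1 : 1 ≤ Γ)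
    (hr : Even (r + 1)) {Λ : ℝ} (hΛ : 0 < Λ)
    (h1 : ∀ s ∈ Finset.Icc 1 q,
      ((r : ℝ) + 1) * (mu P Y f 0 * mu P Y f s * L ^ s * (Γ : ℝ) ^ s * 6144 ^ q) ≤ Λ ^ 2)
    (h2 : ∀ s ∈ Finset.Icc 1 q,
      ((r : ℝ) + 1) ^ s * (mu P Y f s * L ^ s * (Γ : ℝ) ^ s * 6144 ^ q) ≤ Λ) :
    Integrable (fun ω => |eval (fun v => Y v ω) f
      - ∫ ω', eval (fun v => Y v ω') f ∂P| ^ (r + 1)) P ∧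
    ∫ ω, |eval (fun v => Y v ω) f
      - ∫ ω', eval (fun v => Y v ω') f ∂P| ^ (r + 1) ∂P ≤ Λ ^ (r + 1) := by
  have hprob : ∀ v, IsProbabilityMeasure (P.map (Y v)) := fun v =>
    Measure.isProbabilityMeasure_map (hY v).aemeasurable
  have hν := integrable_abs_pow_map hL hY hmb
  rw [(PolyBounded.integrable_comp_and_integral_comp hL hY hind hmb (polyBounded_eval f)).2]
  have hG := ((polyBounded_eval f).sub (PolyBounded.const
    (∫ y, eval y f ∂Measure.pi fun v => P.map (Y v)))).abs.pow (r + 1)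
  have hGP := hG.integrable_comp_and_integral_comp hL hY hind hmb
  refine ⟨hGP.1, ?_⟩
  rw [hGP.2]
  have hmu := mu_nonneg (P := P) (Y := Y) (f := f)
  have hs := isSmooth_of_mu hL hY hmb hq hΓ hΓ1 (show 1 ≤ 2 * (r + 1) by omega)
  have hs' := isSmooth_of_mu hL hY hmb hq hΓ hΓ1 le_rfl
  have hM := sum_mass_le (f := f) hL hY hmb
  set T : ℝ := ∑ s ∈ Finset.Icc 1 q, 2 * ((4 * ((2 * (r + 1) : ℕ) : ℝ) * L * Γ) ^ s * mu P Y f s)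
    with hT
  set T' : ℝ := ∑ s ∈ Finset.Icc 1 q, 2 * ((4 * ((1 : ℕ) : ℝ) * L * Γ) ^ s * mu P Y f s) with hT'
  set M : ℝ := ∑ h ∈ f.support, 2 * |f.coeff h| *
    momentProd (absMoment fun v => P.map (Y v)) h with hMdef
  set k : ℝ := (r : ℝ) + 1 with hk
  have hk0 : 0 < k := by positivity
  have hT0 : 0 ≤ T := hs.T_nonneg
  have hT0' : 0 ≤ T' := hs'.T_nonneg
  have hM0 : 0 ≤ M := Finset.sum_nonneg fun h _ => mul_nonneg (by positivity)
    (hs.momentSeq.momentProd_nonneg h)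
  have hqpow : (q : ℝ) ≤ 2 ^ q := by exact_mod_cast Nat.lt_two_pow_self.le
  have h2pow : (2 : ℝ) ≤ 2 ^ q := by
    simpa using pow_le_pow_right₀ (one_le_two : (1 : ℝ) ≤ 2) hq1
  have hexp : Real.exp q ≤ 3 ^ q := by
    have := pow_le_pow_left₀ (Real.exp_pos 1).le (Real.exp_one_lt_d9.le.trans
      (by norm_num : (2.7182818286 : ℝ) ≤ 3)) q
    rwa [← Real.exp_nat_mul, mul_one] at this
  -- The constant is `6144 = 96 * 64`. Here `96 = 32 * 3`, with `3 ^ q` bounding `exp q`; the pair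
  -- term uses `96 = 2 * 3 * 16`. The spare `64 ^ q` absorbs the numerical factors and the `q` in
  -- front of `τ ^ 2`.
  have hT1 : T * 6144 ^ q ≤ 32 ^ q * Λ := by
    have hterm : ∀ s ∈ Finset.Icc 1 q,
        2 * ((4 * ((2 * (r + 1) : ℕ) : ℝ) * L * Γ) ^ s * mu P Y f s) * 6144 ^ q
          ≤ 2 * 8 ^ q * Λ := by
      intro s hs
      have h3 := h2 s hs
      have h4 : (8 : ℝ) ^ s ≤ 8 ^ q :=
        pow_le_pow_right₀ (by norm_num) (Finset.mem_Icc.1 hs).2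
      have e : 2 * ((4 * ((2 * (r + 1) : ℕ) : ℝ) * L * Γ) ^ s * mu P Y f s) * 6144 ^ q
          = 2 * 8 ^ s * (k ^ s * (mu P Y f s * L ^ s * (Γ : ℝ) ^ s * 6144 ^ q)) := by
        have : (4 * ((2 * (r + 1) : ℕ) : ℝ) * L * Γ) = 8 * k * L * Γ := by
          rw [hk]; push_cast; ring
        rw [this, mul_pow, mul_pow, mul_pow]; ring
      rw [e]
      have hX : 0 ≤ k ^ s * (mu P Y f s * L ^ s * (Γ : ℝ) ^ s * 6144 ^ q) := by
        have := hmu s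
        positivity
      gcongr
    calc T * 6144 ^ q ≤ ∑ s ∈ Finset.Icc 1 q, 2 * 8 ^ q * Λ := by
          rw [hT, Finset.sum_mul]; exact Finset.sum_le_sum hterm
      _ = q * 2 * 8 ^ q * Λ := by simp; ring
      _ ≤ 2 ^ q * 2 ^ q * 8 ^ q * Λ := by gcongr
      _ = 32 ^ q * Λ := by rw [← mul_pow, ← mul_pow]; norm_num
  have hT2 : k * T' * mu P Y f 0 * 6144 ^ q ≤ 16 ^ q * Λ ^ 2 := by
    have hterm : ∀ s ∈ Finset.Icc 1 q,
        2 * ((4 * ((1 : ℕ) : ℝ) * L * Γ) ^ s * mu P Y f s) * (k * mu P Y f 0 * 6144 ^ q)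
          ≤ 2 * 4 ^ q * Λ ^ 2 := by
      intro s hs
      have h3 := h1 s hs
      have h4 : (4 : ℝ) ^ s ≤ 4 ^ q :=
        pow_le_pow_right₀ (by norm_num) (Finset.mem_Icc.1 hs).2
      have e : 2 * ((4 * ((1 : ℕ) : ℝ) * L * Γ) ^ s * mu P Y f s) * (k * mu P Y f 0 * 6144 ^ q)
          = 2 * 4 ^ s * (k * (mu P Y f 0 * mu P Y f s * L ^ s * (Γ : ℝ) ^ s * 6144 ^ q)) := by
        rw [Nat.cast_one, mul_one, mul_pow, mul_pow]; ring
      rw [e]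
      have hX : 0 ≤ k * (mu P Y f 0 * mu P Y f s * L ^ s * (Γ : ℝ) ^ s * 6144 ^ q) := by
        have := hmu s
        have := hmu 0
        positivity
      gcongr
    calc k * T' * mu P Y f 0 * 6144 ^ q = T' * (k * mu P Y f 0 * 6144 ^ q) := by ring
      _ ≤ ∑ s ∈ Finset.Icc 1 q, 2 * 4 ^ q * Λ ^ 2 := by
          rw [hT', Finset.sum_mul]; exact Finset.sum_le_sum hterm
      _ = q * 2 * 4 ^ q * Λ ^ 2 := by simp; ring
      _ ≤ 2 ^ q * 2 ^ q * 4 ^ q * Λ ^ 2 := by gcongr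
      _ = 16 ^ q * Λ ^ 2 := by rw [← mul_pow, ← mul_pow]; norm_num
  have h64 : (64 : ℝ) ≤ 64 ^ q := by
    simpa using pow_le_pow_right₀ (by norm_num : (1 : ℝ) ≤ 64) hq1
  have hτ : T * Real.exp q * 64 ^ q ≤ Λ := by
    have h3 : T * Real.exp q * 6144 ^ q ≤ 96 ^ q * Λ := by
      calc T * Real.exp q * 6144 ^ q = (T * 6144 ^ q) * Real.exp q := by ring
        _ ≤ (32 ^ q * Λ) * 3 ^ q := by gcongr
        _ = (32 * 3) ^ q * Λ := by rw [mul_pow]; ring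
        _ = _ := by norm_num
    have h4 : (6144 : ℝ) ^ q = 96 ^ q * 64 ^ q := by rw [← mul_pow]; norm_num
    rw [h4] at h3
    refine le_of_mul_le_mul_left ?_ (by positivity : (0 : ℝ) < 96 ^ q)
    linarith
  set τ := T * Real.exp q with hτdef
  have hτ0 : 0 ≤ τ := by positivity
  have hpair : q * (k * (T' * Real.exp q) * M) * 64 ^ q ≤ 2 * Λ ^ 2 := by
    have h3 : q * (k * (T' * Real.exp q) * M) * 6144 ^ q ≤ 96 ^ q * (2 * Λ ^ 2) := by
      calc q * (k * (T' * Real.exp q) * M) * 6144 ^ q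
          ≤ 2 ^ q * (k * (T' * 3 ^ q) * (2 * mu P Y f 0)) * 6144 ^ q := by
            gcongr
        _ = 2 ^ q * 3 ^ q * 2 * (k * T' * mu P Y f 0 * 6144 ^ q) := by ring
        _ ≤ 2 ^ q * 3 ^ q * 2 * (16 ^ q * Λ ^ 2) := by gcongr
        _ = (2 * 3 * 16) ^ q * (2 * Λ ^ 2) := by rw [mul_pow, mul_pow]; ring
        _ = _ := by norm_num
    have h4 : (6144 : ℝ) ^ q = 96 ^ q * 64 ^ q := by rw [← mul_pow]; norm_num
    rw [h4] at h3
    refine le_of_mul_le_mul_left ?_ (by positivity : (0 : ℝ) < 96 ^ q)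
    linarith
  have hτ64 : τ * 64 ≤ Λ := (mul_le_mul_of_nonneg_left h64 hτ0).trans hτ
  have hsq : q * τ ^ 2 * 64 ≤ Λ ^ 2 := by
    have e1 : (q : ℝ) ≤ 64 ^ q := hqpow.trans (pow_le_pow_left₀ (by norm_num) (by norm_num) q)
    calc q * τ ^ 2 * 64 = (τ * q) * (τ * 64) := by ring
      _ ≤ (τ * 64 ^ q) * (τ * 64) := by gcongr
      _ ≤ Λ * Λ := by gcongr
      _ = _ := by ring
  refine integral_abs_sub_pow_le hν f hs hs' hMdef.symm hΛ (by linarith) ?_ hr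
  have hpos : 0 ≤ q * (k * (T' * Real.exp q) * M) := by positivity
  have hpair64 := (mul_le_mul_of_nonneg_left h64 hpos).trans hpair
  nlinarith

lemma expNegDiv_le_one {a b : ℝ} (ha : 0 ≤ a) (hb : 0 ≤ b) : expNegDiv a b ≤ 1 := by
  unfold expNegDiv
  split_ifs
  · exact zero_le_one
  · exact Real.exp_le_one_iff.2 (neg_nonpos.2 (div_nonneg ha hb))

lemma expNegDivRoot_le_one {a b : ℝ} (ha : 0 ≤ a) (hb : 0 ≤ b) (r : ℕ) :
    expNegDivRoot a b r ≤ 1 := by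
  unfold expNegDivRoot
  split_ifs
  · exact zero_le_one
  · exact Real.exp_le_one_iff.2 (neg_nonpos.2 (Real.rpow_nonneg (div_nonneg ha hb) _))

lemma mul_le_of_expNegDiv_le {a b κ : ℝ} (ha : 0 ≤ a) (hb : 0 ≤ b)
    (h : expNegDiv a b ≤ Real.exp (-κ)) : κ * b ≤ a := by
  unfold expNegDiv at h
  split_ifs at h with h0
  · simpa [h0] using ha
  · have := Real.exp_le_exp.1 h
    exact (le_div_iff₀ (lt_of_le_of_ne hb (Ne.symm h0))).1 (by linarith)

lemma pow_mul_le_of_expNegDivRoot_le {a b κ : ℝ} (ha : 0 ≤ a) (hb : 0 ≤ b) (hκ : 0 ≤ κ) {r : ℕ}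
    (hr : 1 ≤ r) (h : expNegDivRoot a b r ≤ Real.exp (-κ)) : κ ^ r * b ≤ a := by
  unfold expNegDivRoot at h
  split_ifs at h with h0
  · simpa [h0] using ha
  · have h1 : κ ≤ (a / b) ^ (1 / (r : ℝ)) := by
      have := Real.exp_le_exp.1 h
      linarith
    have h2 := pow_le_pow_left₀ hκ h1 r
    rw [← Real.rpow_natCast (_ ^ _), ← Real.rpow_mul (div_nonneg ha hb), one_div,
      inv_mul_cancel₀ (by positivity), Real.rpow_one] at h2
    exact (le_div_iff₀ (lt_of_le_of_ne hb (Ne.symm h0))).1 h2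

/-- The tail bound with the maximum written as `exp (-κ)`. -/
lemma measure_tail_le (hL : 0 < L) (hY : ∀ v, Measurable (Y v))
    (hind : iIndepFun Y P) (hmb : ∀ v, MomentBounded P (Y v) L) {q Γ : ℕ}
    (hq : f.totalDegree ≤ q) (hΓ : ∀ v, f.degreeOf v ≤ Γ) (hq1 : 1 ≤ q) (hΓ1 : 1 ≤ Γ)
    {t κ : ℝ} (ht : 0 < t)
    (h1 : ∀ s ∈ Finset.Icc 1 q,
      κ * (mu P Y f 0 * mu P Y f s * L ^ s * (Γ : ℝ) ^ s * 55296 ^ q) ≤ t ^ 2)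
    (h2 : ∀ s ∈ Finset.Icc 1 q, 0 ≤ κ →
      κ ^ s * (mu P Y f s * L ^ s * (Γ : ℝ) ^ s * 55296 ^ q) ≤ t) :
    P {ω | t ≤ |eval (fun v => Y v ω) f - ∫ ω', eval (fun v => Y v ω') f ∂P|}
      ≤ ENNReal.ofReal (Real.exp 2 * Real.exp (-κ)) := by
  rw [← Real.exp_add]
  -- For `κ < 2` the right side is at least `1`; otherwise a positive even order `2 * ⌊κ / 2⌋` is
  -- available.
  by_cases hκ : κ < 2
  · refine prob_le_one.trans ?_
    rw [ENNReal.one_le_ofReal]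
    exact Real.one_le_exp (by linarith)
  push Not at hκ
  have hmu := mu_nonneg (P := P) (Y := Y) (f := f)
  obtain ⟨j, hj⟩ : ∃ j, j = ⌊κ / 2⌋₊ := ⟨_, rfl⟩
  have hj1 : 1 ≤ j := by
    rw [hj, Nat.one_le_floor_iff]; linarith
  have hjκ : (2 * j : ℝ) ≤ κ := by
    have := Nat.floor_le (show 0 ≤ κ / 2 by linarith)
    rw [hj]; linarith
  have hκj : κ < 2 * j + 2 := by
    have := Nat.lt_floor_add_one (κ / 2)
    rw [← hj] at this; linarith
  set r := 2 * j - 1 with hr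
  have hr1 : r + 1 = 2 * j := by omega
  have hrk : (r : ℝ) + 1 = 2 * j := by exact_mod_cast hr1
  set Λ := t / Real.exp 1 with hΛ
  have hΛ0 : 0 < Λ := by positivity
  have he3 : Real.exp 1 ≤ 3 := Real.exp_one_lt_d9.le.trans (by norm_num)
  have h9 : (9 : ℝ) ≤ 9 ^ q := by
    simpa using pow_le_pow_right₀ (by norm_num : (1 : ℝ) ≤ 9) hq1
  -- The extra `9 ^ q` over `6144 ^ q` pays for `Λ = t / e`, that is, for `e ^ 2` in one hypothesis
  -- and `e` in the other.
  have hsplit : (55296 : ℝ) ^ q = 9 ^ q * 6144 ^ q := by rw [← mul_pow]; norm_num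
  have hmom := integral_central_moment_le (r := r) hL hY hind hmb hq hΓ hq1 hΓ1
    (by rw [hr1]; exact even_two_mul j) hΛ0
    (by
      intro s hs
      have h3 := h1 s hs
      have hX : 0 ≤ mu P Y f 0 * mu P Y f s * L ^ s * (Γ : ℝ) ^ s * 6144 ^ q := by
        have := hmu 0
        have := hmu s
        positivity
      rw [hrk, hΛ, div_pow, le_div_iff₀ (by positivity)]
      calc 2 * j * (mu P Y f 0 * mu P Y f s * L ^ s * (Γ : ℝ) ^ s * 6144 ^ q) * Real.exp 1 ^ 2
          ≤ κ * (mu P Y f 0 * mu P Y f s * L ^ s * (Γ : ℝ) ^ s * 6144 ^ q) * 9 ^ q := by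
            gcongr
            nlinarith [Real.exp_pos 1]
        _ = κ * (mu P Y f 0 * mu P Y f s * L ^ s * (Γ : ℝ) ^ s * 55296 ^ q) := by
            rw [hsplit]; ring
        _ ≤ t ^ 2 := h3)
    (by
      intro s hs
      have h3 := h2 s hs (by linarith)
      have hX : 0 ≤ mu P Y f s * L ^ s * (Γ : ℝ) ^ s * 6144 ^ q := by
        have := hmu s
        positivity
      rw [hrk, hΛ, le_div_iff₀ (by positivity)]
      calc (2 * j : ℝ) ^ s * (mu P Y f s * L ^ s * (Γ : ℝ) ^ s * 6144 ^ q) * Real.exp 1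
          ≤ κ ^ s * (mu P Y f s * L ^ s * (Γ : ℝ) ^ s * 6144 ^ q) * 9 ^ q := by
            gcongr
            linarith
        _ = κ ^ s * (mu P Y f s * L ^ s * (Γ : ℝ) ^ s * 55296 ^ q) := by
            rw [hsplit]; ring
        _ ≤ t := h3)
  obtain ⟨hint, hle⟩ := hmom
  set X : Ω → ℝ := fun ω => |eval (fun v => Y v ω) f - ∫ ω', eval (fun v => Y v ω') f ∂P| with hX
  have hmarkov := mul_meas_ge_le_integral_of_nonneg (μ := P) (f := fun ω => X ω ^ (r + 1))
    (Filter.Eventually.of_forall fun ω => by positivity) hint (t ^ (r + 1))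
  have hset : {ω | t ≤ X ω} ⊆ {ω | t ^ (r + 1) ≤ X ω ^ (r + 1)} := fun ω hω =>
    pow_le_pow_left₀ ht.le hω _
  have htk : 0 < t ^ (r + 1) := by positivity
  have hreal : P.real {ω | t ≤ X ω} ≤ Real.exp (2 + -κ) := by
    have h3 : P.real {ω | t ≤ X ω} ≤ Λ ^ (r + 1) / t ^ (r + 1) := by
      rw [le_div_iff₀ htk, mul_comm]
      exact (mul_le_mul_of_nonneg_left (measureReal_mono hset) htk.le).trans (hmarkov.trans hle)
    refine h3.trans ?_
    rw [← div_pow, hΛ, div_div, mul_comm, ← div_div, div_self ht.ne', one_div, ← Real.exp_neg,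
      ← Real.exp_nat_mul, Real.exp_le_exp]
    push_cast
    rw [hrk]; linarith
  rw [← ofReal_measureReal]
  exact ENNReal.ofReal_le_ofReal hreal

end Tail

theorem theorem3 :
    ∃ R : ℝ, 0 < R ∧
      ∀ (n q Γ : ℕ) (L : ℝ) (Ω : Type*) [MeasurableSpace Ω] (P : Measure Ω)
        [IsProbabilityMeasure P] (Y : Fin n → Ω → ℝ) (f : MvPolynomial (Fin n) ℝ),
        0 < L →
        (∀ v, Measurable (Y v)) →
        iIndepFun Y P →
        (∀ v, MomentBounded P (Y v) L) →
        f.totalDegree ≤ q →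
        (∀ v, f.degreeOf v ≤ Γ) →
        Integrable (fun ω => MvPolynomial.eval (fun v => Y v ω) f) P ∧
        ∀ t : ℝ, 0 < t →
          P {ω | t ≤ |MvPolynomial.eval (fun v => Y v ω) f
                    - ∫ ω', MvPolynomial.eval (fun v => Y v ω') f ∂P|}
            ≤ ENNReal.ofReal (Real.exp 2) *
              (Finset.Icc 1 q).sup fun r : ℕ =>
                ENNReal.ofReal
                  (max
                    (expNegDiv (t ^ 2)
                      (mu P Y f 0 * mu P Y f r * L ^ r * (Γ : ℝ) ^ r * R ^ q))
                    (expNegDivRoot t (mu P Y f r * L ^ r * (Γ : ℝ) ^ r * R ^ q) r)) := by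
  refine ⟨55296, by norm_num, ?_⟩
  intro n q Γ L Ω _ P _ Y f hL hY hind hmb hq hΓ
  -- For constant `f` the maximum may be `0` and has no logarithm, but the event is empty. Otherwise
  -- `q` and `Γ` are at least `1` and some denominator is positive.
  by_cases hconst : ∃ c, f = MvPolynomial.C c
  · obtain ⟨c, rfl⟩ := hconst
    refine ⟨by simp, fun t ht => ?_⟩
    have : {ω | t ≤ |MvPolynomial.eval (fun v => Y v ω) (MvPolynomial.C c)
        - ∫ ω', MvPolynomial.eval (fun v => Y v ω') (MvPolynomial.C c) ∂P|} = ∅ := by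
      ext ω
      simp [ht]
    rw [this, measure_empty]
    exact zero_le
  push Not at hconst
  have hmu := mu_nonneg (P := P) (Y := Y) (f := f)
  obtain ⟨h, hh, h0, hpos⟩ := exists_mu_pos (P := P) (Y := Y) hconst
  obtain ⟨v, hv⟩ := Finsupp.ne_iff.1 h0
  have hΓ1 : 1 ≤ Γ :=
    (Nat.one_le_iff_ne_zero.2 hv).trans ((MvPolynomial.monomial_le_degreeOf v hh).trans (hΓ v))
  have hd1 : 1 ≤ h.degree := by
    rw [Nat.one_le_iff_ne_zero]
    exact fun hz => h0 ((Finsupp.degree_eq_zero_iff h).1 hz)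
  have hdq : h.degree ≤ q := (degree_le_totalDegree_of_mem hh).trans hq
  have hq1 : 1 ≤ q := hd1.trans hdq
  refine ⟨?_, fun t ht => ?_⟩
  · exact ((polyBounded_eval f).integrable_comp_and_integral_comp hL hY hind hmb).1
  have hden : ∀ r, 0 ≤ mu P Y f r * L ^ r * (Γ : ℝ) ^ r * 55296 ^ q := fun r => by
    have := hmu r
    positivity
  have hden0 : ∀ r, 0 ≤ mu P Y f 0 * mu P Y f r * L ^ r * (Γ : ℝ) ^ r * 55296 ^ q := fun r => by
    have := hmu r
    have := hmu 0
    positivity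
  set V : ENNReal := (Finset.Icc 1 q).sup fun r : ℕ =>
    ENNReal.ofReal (max
      (expNegDiv (t ^ 2) (mu P Y f 0 * mu P Y f r * L ^ r * (Γ : ℝ) ^ r * 55296 ^ q))
      (expNegDivRoot t (mu P Y f r * L ^ r * (Γ : ℝ) ^ r * 55296 ^ q) r)) with hV
  have hV1 : V ≤ 1 := Finset.sup_le fun r _ => by
    rw [ENNReal.ofReal_le_one]
    exact max_le (expNegDiv_le_one (by positivity) (hden0 r))
      (expNegDivRoot_le_one ht.le (hden r) r)
  have hVtop : V ≠ ⊤ := (hV1.trans_lt ENNReal.one_lt_top).ne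
  have hle : ∀ s ∈ Finset.Icc 1 q, max
      (expNegDiv (t ^ 2) (mu P Y f 0 * mu P Y f s * L ^ s * (Γ : ℝ) ^ s * 55296 ^ q))
      (expNegDivRoot t (mu P Y f s * L ^ s * (Γ : ℝ) ^ s * 55296 ^ q) s) ≤ V.toReal := by
    intro s hs
    rw [← ENNReal.ofReal_le_iff_le_toReal hVtop]
    exact Finset.le_sup (f := fun r : ℕ => ENNReal.ofReal (max
      (expNegDiv (t ^ 2) (mu P Y f 0 * mu P Y f r * L ^ r * (Γ : ℝ) ^ r * 55296 ^ q))
      (expNegDivRoot t (mu P Y f r * L ^ r * (Γ : ℝ) ^ r * 55296 ^ q) r))) hs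
  have hVpos : 0 < V.toReal := by
    refine lt_of_lt_of_le ?_ ((le_max_right _ _).trans (hle h.degree
      (Finset.mem_Icc.2 ⟨hd1, hdq⟩)))
    unfold expNegDivRoot
    rw [if_neg]
    · exact Real.exp_pos _
    · have : (0 : ℝ) < Γ := by exact_mod_cast hΓ1
      positivity
  -- The choice `κ = -log V` writes the maximum as `exp (-κ)`, so each term being at most `V`
  -- unfolds to a condition on `κ`.
  have hκ : Real.exp (- -Real.log V.toReal) = V.toReal := by rw [neg_neg, Real.exp_log hVpos]
  have hfinal := measure_tail_le (κ := -Real.log V.toReal) hL hY hind hmb hq hΓ hq1 hΓ1 ht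
    (fun s hs => mul_le_of_expNegDiv_le (by positivity) (hden0 s)
      (by rw [hκ]; exact (le_max_left _ _).trans (hle s hs)))
    (fun s hs hκ0 => pow_mul_le_of_expNegDivRoot_le ht.le (hden s) hκ0 (Finset.mem_Icc.1 hs).1
      (by rw [hκ]; exact (le_max_right _ _).trans (hle s hs)))
  rwa [hκ, ENNReal.ofReal_mul (Real.exp_pos 2).le, ENNReal.ofReal_toReal hVtop] at hfinal
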